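/- In the membership-query model for Set Cover, an algorithm is given $n$ and $m$ and accesses an instance $(\mathcal U,\mathcal F)$, with $|\mathcal U|=n$ and $\mathcal F=\{S_1,\dots,S_m\}$ a family of subsets of $\mathcal U$, only through constant-time queries $\mathrm{contains}(S,x)$, $S\in\mathcal F$, $x\in\mathcal U$, which return $1$ if $x\in S$ and $0$ otherwise. Time is counted on a randomized word RAM with words of $w\ge \kappa\log_2(n+m)$ bits for an absolute constant $\kappa$, where an arithmetic operation, a memory access, a membership query and the choice of a uniformly random element of $\{0,\dots,y\}$ for a word $y$ take one step each. There is a randomized algorithm in the membership-query model and there are absolute constants $A,B,C>0$ and $p\in\mathbb N$ such that for every instance $(\mathcal U,\mathcal F)$ with $|\mathcal U|=n\ge 2$ and $|\mathcal F|=m$ that has a cover (a subfamily of $\mathcal F$ whose union is $\mathcal U$), with $k$ the minimum size of a cover, the following hold. 1. For every outcome of its random choices, the algorithm halts in time at most $C\,(mk+nk)\,\log^{p}(n+m)$, that is, in time $\tilde O(mk+nk)$. 2. With probability at least $1-B/n^2$, it returns a cover that consists of at most $A\,k\ln n$ sets, that is, an $O(\ln n)$-approximate minimum set cover. -/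

import Mathlib

namespace SetCoverRAM

/-! ### Set cover -/

/-- The sets of the family `S` (over the universe `Fin n`) with index in `T` cover the universe. -/
def IsCover {n m : ℕ} (S : Fin m → Finset (Fin n)) (T : Finset (Fin m)) : Prop :=
  ∀ x : Fin n, ∃ s ∈ T, x ∈ S s

/-- `k` is the minimum number of sets in a cover; in particular, a cover exists. -/
def IsMinCoverSize {n m : ℕ} (S : Fin m → Finset (Fin n)) (k : ℕ) : Prop :=
  IsLeast {c : ℕ | ∃ T : Finset (Fin m), IsCover S T ∧ T.card = c} k

/-! ### A randomized word RAM with membership queries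

The memory consists of registers and of random-access arrays. Registers and arrays are named
by numbers that are fixed in the program (so a program uses finitely many of them), and every
register and every array cell holds one `w`-bit word. -/

/-- Arithmetic and comparison on words. -/
inductive Op where
  | add
  | sub
  | mul
  | div
  | lt
  | eq

/-- The value of an operation before it is reduced to a word (`sub` is truncated at `0`, division
is rounded down and division by `0` gives `0`, comparisons give `0` or `1`). -/
def Op.eval : Op → ℕ → ℕ → ℕ
  | .add, a, b => a + b
  | .sub, a, b => a - b
  | .mul, a, b => a * b
  | .div, a, b => a / b
  | .lt, a, b => if a < b then 1 else 0
  | .eq, a, b => if a = b then 1 else 0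

/-- Programs. A program is a finite object and does not depend on the input. -/
inductive Cmd where
  /-- Do nothing. -/
  | skip
  /-- `x := c` for a fixed number `c`. -/
  | const (x c : ℕ)
  /-- `x := op y z`. -/
  | arith (o : Op) (x y z : ℕ)
  /-- `x := a[i]`, where the array `a` is fixed and the register `i` holds the address. -/
  | load (x a i : ℕ)
  /-- `a[i] := x`. -/
  | store (a i x : ℕ)
  /-- `x :=` a fresh uniformly random element of `{0, …, y}`. -/
  | rand (x y : ℕ)
  /-- `x := contains(s, e)`, a membership query. -/
  | query (x s e : ℕ)
  /-- First `c`, then `d`. -/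
  | seq (c d : Cmd)
  /-- If the register `x` is nonzero then `c` else `d`. -/
  | ite (x : ℕ) (c d : Cmd)
  /-- While the register `x` is nonzero do `c`. -/
  | loop (x : ℕ) (c : Cmd)

/-- The memory of the machine. -/
@[ext] structure Mem where
  /-- The registers. -/
  reg : ℕ → ℕ
  /-- The arrays: `arr a i` is the cell of the array `a` with address `i`. -/
  arr : ℕ → ℕ → ℕ

/-- Write a word of `w` bits to a register. -/
def Mem.setReg (w : ℕ) (M : Mem) (x v : ℕ) : Mem :=
  { M with reg := Function.update M.reg x (v % 2 ^ w) }

/-- Write a word of `w` bits to an array cell. -/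
def Mem.setArr (w : ℕ) (M : Mem) (a i v : ℕ) : Mem :=
  { M with arr := Function.update M.arr a (Function.update (M.arr a) i (v % 2 ^ w)) }

/-- A configuration: the commands that remain to be executed, and the memory. -/
@[ext] structure Config where
  /-- The commands that remain, the next one first. -/
  todo : List Cmd
  /-- The current memory. -/
  mem : Mem

/-- The machine has halted when there is nothing left to execute. -/
def Config.Halted (c : Config) : Prop := c.todo = []

/-- The answer to a membership query: `1` if `s` is the number of a set, `e` is the number of an
element, and the element lies in the set, and `0` otherwise. -/
def answer {n m : ℕ} (S : Fin m → Finset (Fin n)) (s e : ℕ) : ℕ :=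
  if h : s < m ∧ e < n then (if (⟨e, h.2⟩ : Fin n) ∈ S ⟨s, h.1⟩ then 1 else 0) else 0

/-- One time step of the machine with word length `w` on the input `S`: the next command is
executed (arithmetic, memory access, random choice and membership query take one step each), or it
is decomposed. The input is accessed in the clause for `query` only. A halted machine stays as it
is. -/
noncomputable def step {n m : ℕ} (w : ℕ) (S : Fin m → Finset (Fin n)) : Config → PMF Config
  | ⟨[], M⟩ => PMF.pure ⟨[], M⟩
  | ⟨.skip :: K, M⟩ => PMF.pure ⟨K, M⟩
  | ⟨.const x c :: K, M⟩ => PMF.pure ⟨K, M.setReg w x c⟩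
  | ⟨.arith o x y z :: K, M⟩ => PMF.pure ⟨K, M.setReg w x (o.eval (M.reg y) (M.reg z))⟩
  | ⟨.load x a i :: K, M⟩ => PMF.pure ⟨K, M.setReg w x (M.arr a (M.reg i))⟩
  | ⟨.store a i x :: K, M⟩ => PMF.pure ⟨K, M.setArr w a (M.reg i) (M.reg x)⟩
  | ⟨.rand x y :: K, M⟩ =>
      (PMF.uniformOfFintype (Fin (M.reg y + 1))).map
        fun r : Fin (M.reg y + 1) => ⟨K, M.setReg w x r.val⟩
  | ⟨.query x s e :: K, M⟩ => PMF.pure ⟨K, M.setReg w x (answer S (M.reg s) (M.reg e))⟩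
  | ⟨.seq c d :: K, M⟩ => PMF.pure ⟨c :: d :: K, M⟩
  | ⟨.ite x c d :: K, M⟩ => PMF.pure ⟨(if M.reg x ≠ 0 then c else d) :: K, M⟩
  | ⟨.loop x c :: K, M⟩ => PMF.pure ⟨if M.reg x ≠ 0 then c :: .loop x c :: K else K, M⟩

/-- The distribution of the configuration after `t` time steps. -/
noncomputable def steps {n m : ℕ} (w : ℕ) (S : Fin m → Finset (Fin n)) :
    ℕ → Config → PMF Config
  | 0, c => PMF.pure c
  | t + 1, c => (step w S c).bind (steps w S t)

/-- The initial configuration of the program `P`: the register `0` holds the size `n` of the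
universe, the register `1` holds the number `m` of sets, and the rest of the memory is zero. -/
def init (P : Cmd) (w n m : ℕ) : Config :=
  ⟨[P], (Mem.setReg w (Mem.setReg w ⟨fun _ => 0, fun _ _ => 0⟩ 0 n) 1 m)⟩

/-- The distribution of the configuration of the program `P` on the input `S` after `t` time
steps. -/
noncomputable def run {n m : ℕ} (P : Cmd) (w : ℕ) (S : Fin m → Finset (Fin n)) (t : ℕ) :
    PMF Config :=
  steps w S t (init P w n m)

/-- The machine halts within `t` time steps, whatever the outcomes of the random choices are. -/
def HaltsWithin {n m : ℕ} (P : Cmd) (w : ℕ) (S : Fin m → Finset (Fin n)) (t : ℕ) : Prop :=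
  ∀ c ∈ (run P w S t).support, c.Halted

/-- The output of a configuration: the register `0` holds its length, and the array `0` holds its
entries. -/
def Config.output (c : Config) : List ℕ :=
  (List.range (c.mem.reg 0)).map (c.mem.arr 0)

/-- The machine has halted, and its output lists the indices in `T` without repetition. -/
def Config.Returns {m : ℕ} (c : Config) (T : Finset (Fin m)) : Prop :=
  c.Halted ∧ ∃ l : List (Fin m), l.Nodup ∧ l.toFinset = T ∧ l.map Fin.val = c.output

end SetCoverRAM

open scoped ENNReal

namespace SetCoverRAM

variable {n m : ℕ} {w : ℕ} {S : Fin m → Finset (Fin n)}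

/-! ### Expectations over runs -/

/-! The algorithm keeps a guess g for k, initially 1, and the list U of uncovered elements. With L =
⌈log₂(n+m)⌉, a round draws 6Lg elements of U independently, then goes once through the sets and
takes each set that hits at least 3L of the still uncovered samples. Every choice removes at least
3L samples, so a round takes at most 2g sets, and afterwards every set hits fewer than 3L of the
remaining samples (`passCmd_spec`). If more than half of the samples remain, then g < k, because k
sets cover them with fewer than 3L hits each (`IsMinCoverSize.length_le`); only then is g doubled,
so g ≤ 2k always. Otherwise at most 2g sets cover half of the sample, and they cover at least a
sixteenth of U unless the sample is misleading. Exponential moments and a union bound over families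
of 2g sets give a misleading sample probability at most m^(2g) · 2^(-6Lg) ≤ (n+m)^(-4)
(`sampleCmd_spec`, `round_error_le`).

If no sample misleads, each round doubles g or shrinks U by the factor 15/16. Since g ≤ 2k ≤ 2n, U
is empty after O(log n) rounds (`OnTrack.succ`, `OnTrack.eq_zero`), so a limit of 33L rounds
suffices and the output has at most 4k · O(log n) sets. The running time does not depend on luck:
the limit on rounds and g ≤ 2k hold for all outcomes.

For the machine model, one quantity controls both time and error: the expectation after t steps of a
function that is ⊤ on unfinished configurations and the failure indicator on halted ones. A finite
bound forces halting within t steps for every outcome, and its value bounds the failure probability.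
`ProbTriple` is a Hoare triple for such expectations, quantified over the continuation `K`, the
later time `T` and an additive slack `a`; `DetTriple` treats commands without random choices. -/

/-- The expectation of `F` after `T` steps from `c`. -/
noncomputable def expect (w : ℕ) (S : Fin m → Finset (Fin n)) (T : ℕ) (c : Config)
    (F : Config → ℝ≥0∞) : ℝ≥0∞ :=
  ∑' c', steps w S T c c' * F c'

/-- `F` is infinite on all configurations that have not halted. -/
def TopUnlessHalted (F : Config → ℝ≥0∞) : Prop := ∀ c, ¬ c.Halted → F c = ⊤

theorem expect_zero (c : Config) (F : Config → ℝ≥0∞) : expect w S 0 c F = F c := by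
  classical
  unfold expect steps
  rw [tsum_eq_single c]
  · simp
  · intro c' hc
    simp [PMF.pure_apply, hc]

theorem tsum_bind_mul {α β : Type*} (p : PMF α) (q : α → PMF β) (F : β → ℝ≥0∞) :
    ∑' b, p.bind q b * F b = ∑' a, p a * ∑' b, q a b * F b := by
  simp_rw [PMF.bind_apply, ← ENNReal.tsum_mul_right, ← ENNReal.tsum_mul_left, mul_assoc]
  exact ENNReal.tsum_comm

theorem expect_succ (T : ℕ) (c : Config) (F : Config → ℝ≥0∞) :
    expect w S (T + 1) c F = ∑' c', step w S c c' * expect w S T c' F := by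
  unfold expect
  exact tsum_bind_mul _ _ _

theorem steps_succ_of_pure {c c' : Config} (h : step w S c = PMF.pure c') (T : ℕ) :
    steps w S (T + 1) c = steps w S T c' := by
  rw [steps, h, PMF.pure_bind]

/-- A halted configuration does not move, and elsewhere `F` is already ⊤, so additional time can
only lower the expectation. This is what lets time bounds be weakened freely. -/
theorem expect_succ_le {F : Config → ℝ≥0∞} (hF : TopUnlessHalted F) (T : ℕ) (c : Config) :
    expect w S (T + 1) c F ≤ expect w S T c F := by
  induction T generalizing c with
  | zero =>
    rw [expect_zero]
    by_cases hc : c.Halted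
    · obtain ⟨K, M⟩ := c
      obtain rfl : K = [] := hc
      have : step w S ⟨[], M⟩ = PMF.pure ⟨[], M⟩ := rfl
      rw [expect, steps_succ_of_pure this]
      exact (expect_zero _ _).le
    · rw [hF c hc]; exact le_top
  | succ T ih =>
    rw [expect_succ, expect_succ T]
    exact ENNReal.tsum_le_tsum fun c' => by gcongr; exact ih c'

theorem expect_antitone {F : Config → ℝ≥0∞} (hF : TopUnlessHalted F) (c : Config) :
    Antitone fun T => expect w S T c F :=
  antitone_nat_of_succ_le fun T => expect_succ_le hF T c

/-! ### Memory without word overflow -/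

/-- Set the register `x` to `v`. -/
def Mem.put (M : Mem) (x v : ℕ) : Mem := { M with reg := Function.update M.reg x v }

/-- Set the cell `i` of the array `a` to `v`. -/
def Mem.putArr (M : Mem) (a i v : ℕ) : Mem :=
  { M with arr := Function.update M.arr a (Function.update (M.arr a) i v) }

theorem Mem.setReg_eq_put {v : ℕ} (hv : v < 2 ^ w) (M : Mem) (x : ℕ) :
    M.setReg w x v = M.put x v := by
  simp [Mem.setReg, Mem.put, Nat.mod_eq_of_lt hv]

theorem Mem.setArr_eq_putArr {v : ℕ} (hv : v < 2 ^ w) (M : Mem) (a i : ℕ) :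
    M.setArr w a i v = M.putArr a i v := by
  simp [Mem.setArr, Mem.putArr, Nat.mod_eq_of_lt hv]

@[simp] theorem Mem.put_reg (M : Mem) (x v y : ℕ) :
    (M.put x v).reg y = if y = x then v else M.reg y := by
  simp [Mem.put, Function.update_apply]

@[simp] theorem Mem.put_arr (M : Mem) (x v : ℕ) : (M.put x v).arr = M.arr := rfl

@[simp] theorem Mem.putArr_reg (M : Mem) (a i v : ℕ) : (M.putArr a i v).reg = M.reg := rfl

@[simp] theorem Mem.putArr_arr_same (M : Mem) (a i v : ℕ) :
    (M.putArr a i v).arr a = Function.update (M.arr a) i v := by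
  simp [Mem.putArr]

theorem Mem.putArr_arr_ne (M : Mem) {a b : ℕ} (h : b ≠ a) (i v : ℕ) :
    (M.putArr a i v).arr b = M.arr b := by
  simp [Mem.putArr, h]

/-- The list of the first `l` entries of the array `a`. -/
def Mem.list (M : Mem) (a l : ℕ) : List ℕ := (List.range l).map (M.arr a)

@[simp] theorem Mem.length_list (M : Mem) (a l : ℕ) : (M.list a l).length = l := by
  simp [Mem.list]

@[simp] theorem Mem.list_zero (M : Mem) (a : ℕ) : M.list a 0 = [] := rfl

theorem Mem.list_succ (M : Mem) (a l : ℕ) : M.list a (l + 1) = M.list a l ++ [M.arr a l] := by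
  simp [Mem.list, List.range_succ]

theorem Mem.list_congr {M M' : Mem} {a l : ℕ} (h : ∀ i < l, M'.arr a i = M.arr a i) :
    M'.list a l = M.list a l := by
  simpa [Mem.list] using h

theorem Mem.arr_mem_list (M : Mem) {a l i : ℕ} (h : i < l) : M.arr a i ∈ M.list a l := by
  simp only [Mem.list, List.mem_map, List.mem_range]
  exact ⟨i, h, rfl⟩

theorem Mem.list_of_update {M M' : Mem} {a l v : ℕ}
    (h : M'.arr a = Function.update (M.arr a) l v) : M'.list a (l + 1) = M.list a l ++ [v] := by
  rw [Mem.list_succ, h, Function.update_self,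
    Mem.list_congr (M := M) fun i hi => by rw [h, Function.update_of_ne hi.ne]]

@[simp] theorem Mem.put_list (M : Mem) (x v a l : ℕ) : (M.put x v).list a l = M.list a l := rfl

theorem Mem.putArr_list_ne (M : Mem) {a b : ℕ} (h : b ≠ a) (i v l : ℕ) :
    (M.putArr a i v).list b l = M.list b l :=
  Mem.list_congr fun j _ => by rw [Mem.putArr_arr_ne _ h]

/-! ### Triples for deterministic commands -/

/-- From the memory `M`, the command `c` takes at most `t` steps, makes no random choice,
and ends in a memory that satisfies `Q`. -/
def DetTriple (w : ℕ) (S : Fin m → Finset (Fin n)) (c : Cmd) (M : Mem) (t : ℕ)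
    (Q : Mem → Prop) : Prop :=
  ∃ M', Q M' ∧ ∃ t' ≤ t, ∀ K T, steps w S (t' + T) ⟨c :: K, M⟩ = steps w S T ⟨K, M'⟩

namespace DetTriple

variable {c d : Cmd} {M : Mem} {t t₁ t₂ : ℕ} {Q R : Mem → Prop}

theorem mono (h : DetTriple w S c M t₁ R) (ht : t₁ ≤ t) (hQ : ∀ M', R M' → Q M') :
    DetTriple w S c M t Q := by
  obtain ⟨M', hR, t', ht', hs⟩ := h
  exact ⟨M', hQ _ hR, t', ht'.trans ht, hs⟩

theorem of_pure {M' : Mem} (h : ∀ K, step w S ⟨c :: K, M⟩ = PMF.pure ⟨K, M'⟩) (hQ : Q M') :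
    DetTriple w S c M 1 Q :=
  ⟨M', hQ, 1, le_rfl, fun K T => by rw [add_comm, steps_succ_of_pure (h K)]⟩

theorem seq (hc : DetTriple w S c M t₁ R) (hd : ∀ M', R M' → DetTriple w S d M' t₂ Q) :
    DetTriple w S (.seq c d) M (t₁ + t₂ + 1) Q := by
  obtain ⟨M₁, h₁, s₁, hs₁, e₁⟩ := hc
  obtain ⟨M₂, h₂, s₂, hs₂, e₂⟩ := hd M₁ h₁
  refine ⟨M₂, h₂, s₁ + s₂ + 1, by omega, fun K T => ?_⟩
  rw [show s₁ + s₂ + 1 + T = s₁ + (s₂ + T) + 1 by ring,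
    steps_succ_of_pure (c' := ⟨c :: d :: K, M⟩) rfl, e₁, e₂]

theorem skip (h : Q M) : DetTriple w S .skip M 1 Q := of_pure (fun _ => rfl) h

/-- This and the following rules treat a command together with its successor, so that straight-line
code is verified by chaining. The side condition that the value fits in a word replaces `setReg` by
`put` and removes all reductions mod 2 ^ w. -/
theorem const_seq {x v : ℕ} (hv : v < 2 ^ w) (h : DetTriple w S d (M.put x v) t Q) :
    DetTriple w S (.seq (.const x v) d) M (t + 2) Q :=
  (seq (R := (· = M.put x v)) (of_pure (fun _ => rfl) (Mem.setReg_eq_put hv M x))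
    (by rintro _ rfl; exact h)).mono (by omega) fun _ => id

theorem arith_seq {o : Op} {x y z : ℕ} (v : ℕ) (he : o.eval (M.reg y) (M.reg z) = v)
    (hv : v < 2 ^ w) (h : DetTriple w S d (M.put x v) t Q) :
    DetTriple w S (.seq (.arith o x y z) d) M (t + 2) Q :=
  (seq (R := (· = M.put x v)) (of_pure (fun _ => rfl) (by rw [he, Mem.setReg_eq_put hv]))
    (by rintro _ rfl; exact h)).mono (by omega) fun _ => id

theorem load_seq {x a i : ℕ} (v : ℕ) (he : M.arr a (M.reg i) = v)
    (hv : v < 2 ^ w) (h : DetTriple w S d (M.put x v) t Q) :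
    DetTriple w S (.seq (.load x a i) d) M (t + 2) Q :=
  (seq (R := (· = M.put x v)) (of_pure (fun _ => rfl) (by rw [he, Mem.setReg_eq_put hv]))
    (by rintro _ rfl; exact h)).mono (by omega) fun _ => id

theorem store_seq {a i x : ℕ} (j v : ℕ) (hi : M.reg i = j) (hx : M.reg x = v)
    (hv : v < 2 ^ w) (h : DetTriple w S d (M.putArr a j v) t Q) :
    DetTriple w S (.seq (.store a i x) d) M (t + 2) Q :=
  (seq (R := (· = M.putArr a j v))
    (of_pure (fun _ => rfl) (by rw [hi, hx, Mem.setArr_eq_putArr hv]))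
    (by rintro _ rfl; exact h)).mono (by omega) fun _ => id

theorem answer_le_one (s e : ℕ) : answer S s e ≤ 1 := by
  unfold answer; split_ifs <;> simp

theorem query_seq {x s e : ℕ} (i j : ℕ) (hi : M.reg s = i) (hj : M.reg e = j) (hw : 1 < 2 ^ w)
    (h : DetTriple w S d (M.put x (answer S i j)) t Q) :
    DetTriple w S (.seq (.query x s e) d) M (t + 2) Q :=
  (seq (R := (· = M.put x (answer S i j)))
    (of_pure (fun _ => rfl)
      (by rw [hi, hj, Mem.setReg_eq_put ((answer_le_one _ _).trans_lt hw)]))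
    (by rintro _ rfl; exact h)).mono (by omega) fun _ => id

theorem ite {x : ℕ} (h₁ : M.reg x ≠ 0 → DetTriple w S c M t Q)
    (h₂ : M.reg x = 0 → DetTriple w S d M t Q) :
    DetTriple w S (.ite x c d) M (t + 1) Q := by
  have h : DetTriple w S (if M.reg x ≠ 0 then c else d) M t Q := by
    split_ifs with h
    · exact h₁ h
    · exact h₂ (not_not.mp h)
  obtain ⟨M', hQ, t', ht', e⟩ := h
  refine ⟨M', hQ, t' + 1, by omega, fun K T => ?_⟩
  rw [show t' + 1 + T = t' + T + 1 by ring,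
    steps_succ_of_pure (c' := ⟨(if M.reg x ≠ 0 then c else d) :: K, M⟩) rfl, e]

/-- The rule for loops, with an invariant `I` and a bound `τ` for the remaining time. -/
theorem loop {x : ℕ} (I : Mem → Prop) (τ : Mem → ℕ)
    (hbody : ∀ M, I M → M.reg x ≠ 0 →
      ∃ t, DetTriple w S c M t fun M' => I M' ∧ t + 1 + τ M' ≤ τ M)
    (hI : I M) : DetTriple w S (.loop x c) M (τ M + 1) fun M' => I M' ∧ M'.reg x = 0 := by
  induction h : τ M using Nat.strong_induction_on generalizing M with
  | _ N ih =>
  subst h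
  by_cases hx : M.reg x = 0
  · refine (of_pure (M' := M) (fun K => ?_) ⟨hI, hx⟩).mono (by omega) fun _ => id
    simp [step, hx]
  · obtain ⟨t, M₁, ⟨h₁, hτ⟩, t₁, ht₁, e₁⟩ := hbody M hI hx
    obtain ⟨M₂, h₂, t₂, ht₂, e₂⟩ := ih (τ M₁) (by omega) h₁ rfl
    refine ⟨M₂, h₂, t₁ + t₂ + 1, by omega, fun K T => ?_⟩
    rw [show t₁ + t₂ + 1 + T = t₁ + (t₂ + T) + 1 by ring,
      steps_succ_of_pure (c' := ⟨c :: .loop x c :: K, M⟩) (by simp [step, hx]), e₁, e₂]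

end DetTriple

/-! ### Triples for expectations -/

/-- From the memory `M`, the command `c` takes at most `t` steps, ends in a memory that satisfies
`Q` for all outcomes of the random choices, and the expectation of `f` at the end is at most
`b`. -/
def ProbTriple (w : ℕ) (S : Fin m → Finset (Fin n)) (c : Cmd) (M : Mem) (t : ℕ)
    (Q : Mem → Prop) (f : Mem → ℝ≥0∞) (b : ℝ≥0∞) : Prop :=
  ∀ K T F a, TopUnlessHalted F → (∀ M', Q M' → expect w S T ⟨K, M'⟩ F ≤ f M' + a) →
    expect w S (t + T) ⟨c :: K, M⟩ F ≤ b + a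

namespace ProbTriple

variable {c d : Cmd} {M : Mem} {t t₁ t₂ : ℕ} {Q R : Mem → Prop} {f g : Mem → ℝ≥0∞} {b b' : ℝ≥0∞}

theorem mono (h : ProbTriple w S c M t₁ R g b') (ht : t₁ ≤ t) (hQ : ∀ M', R M' → Q M')
    (hf : ∀ M', R M' → f M' ≤ g M') (hb : b' ≤ b) : ProbTriple w S c M t Q f b := by
  intro K T F a hF hK
  refine (expect_antitone hF _ (by omega : t₁ + T ≤ t + T)).trans
    ((h K T F a hF fun M' hM => (hK M' (hQ _ hM)).trans ?_).trans ?_)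
  · gcongr
    exact hf _ hM
  · gcongr

/-- The slack `a` in the triple absorbs the constant. In the main loop the constant is the error
already incurred together with the error reserved for later rounds. -/
theorem add_const (h : ProbTriple w S c M t Q f b) (e : ℝ≥0∞) :
    ProbTriple w S c M t Q (fun M' => f M' + e) (b + e) := by
  intro K T F a hF hK
  rw [add_assoc]
  exact h K T F (e + a) hF fun M' hM' => (hK M' hM').trans (add_assoc _ _ _).le

theorem of_det (h : DetTriple w S c M t fun M' => Q M' ∧ f M' ≤ b) :
    ProbTriple w S c M t Q f b := by
  intro K T F a hF hK
  obtain ⟨M', ⟨hQ, hf⟩, t', ht', e⟩ := h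
  refine (expect_antitone hF _ (by omega : t' + T ≤ t + T)).trans ?_
  simp only [expect, e]
  refine (hK M' hQ).trans ?_
  gcongr

/-- Because triples quantify over the continuation, composition is substitution: the first command
is applied with `d :: K` as its continuation. -/
theorem seq (hc : ProbTriple w S c M t₁ R g b)
    (hd : ∀ M', R M' → ProbTriple w S d M' t₂ Q f (g M')) :
    ProbTriple w S (.seq c d) M (t₁ + t₂ + 1) Q f b := by
  intro K T F a hF hK
  rw [show t₁ + t₂ + 1 + T = t₁ + (t₂ + T) + 1 by ring, expect,
    steps_succ_of_pure (c' := ⟨c :: d :: K, M⟩) rfl]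
  exact hc _ _ F a hF fun M' hM' => hd M' hM' _ _ F a hF hK

theorem rand_seq {x y u : ℕ} (hy : M.reg y + 1 = u) (hu : u ≤ 2 ^ w) {f' : ℕ → ℝ≥0∞}
    (h : ∀ r < u, ProbTriple w S d (M.put x r) t Q f (f' r))
    (hb : (∑ r ∈ Finset.range u, f' r) / u ≤ b) :
    ProbTriple w S (.seq (.rand x y) d) M (t + 2) Q f b := by
  subst hy
  intro K T F a hF hK
  have hmean : (∑ r ∈ Finset.range (M.reg y + 1), (f' r + a)) / (M.reg y + 1 : ℕ) ≤ b + a := by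
    rw [Finset.sum_add_distrib, ENNReal.add_div, Finset.sum_const, Finset.card_range, nsmul_eq_mul,
      mul_comm, ENNReal.mul_div_cancel_right (by simp) (by simp)]
    gcongr
  refine le_trans ?_ hmean
  rw [show t + 2 + T = t + T + 1 + 1 by ring, expect,
    steps_succ_of_pure (c' := ⟨.rand x y :: d :: K, M⟩) rfl, steps]
  simp only [step]
  rw [PMF.bind_map, tsum_bind_mul, tsum_fintype, ENNReal.div_eq_inv_mul, Finset.mul_sum,
    Finset.sum_range]
  refine Finset.sum_le_sum fun r _ => ?_
  simp only [PMF.uniformOfFintype_apply, Fintype.card_fin, Function.comp]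
  gcongr
  rw [Mem.setReg_eq_put (r.2.trans_le hu)]
  exact h r r.2 K T F a hF hK

/-- Here `φ` plays the role of a supermartingale along the iterations, while `τ` is a time budget
that decreases for every outcome, so no optional stopping argument is needed. -/
theorem loop {x : ℕ} (I : Mem → Prop) (τ : Mem → ℕ) (φ : Mem → ℝ≥0∞)
    (hbody : ∀ M, I M → M.reg x ≠ 0 →
      ∃ t ≤ τ M, ProbTriple w S c M t (fun M' => I M' ∧ t + 1 + τ M' ≤ τ M) φ (φ M))
    (hI : I M) :
    ProbTriple w S (.loop x c) M (τ M + 1) (fun M' => I M' ∧ M'.reg x = 0) φ (φ M) := by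
  induction h : τ M using Nat.strong_induction_on generalizing M with
  | _ N ih =>
  subst h
  intro K T F a hF hK
  by_cases hx : M.reg x = 0
  · have : steps w S (τ M + 1 + T) ⟨.loop x c :: K, M⟩ = steps w S (τ M + T) ⟨K, M⟩ := by
      rw [show τ M + 1 + T = τ M + T + 1 by ring]
      exact steps_succ_of_pure (by simp [step, hx]) _
    simp only [expect, this]
    exact (expect_antitone hF _ (by omega : T ≤ τ M + T)).trans (hK M ⟨hI, hx⟩)
  · obtain ⟨t, hle, ht⟩ := hbody M hI hx
    have : steps w S (τ M + 1 + T) ⟨.loop x c :: K, M⟩ =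
        steps w S (τ M + T) ⟨c :: .loop x c :: K, M⟩ := by
      rw [show τ M + 1 + T = τ M + T + 1 by ring]
      exact steps_succ_of_pure (by simp [step, hx]) _
    simp only [expect, this]
    -- The split needs `t ≤ τ M` as a separate hypothesis: the budget inequality is only available
    -- at the memories after the body.
    rw [show τ M + T = t + (τ M - t + T) by omega]
    refine ht _ _ F a hF fun M' hM' => ?_
    exact (expect_antitone hF _ (by omega : τ M' + 1 + T ≤ τ M - t + T)).trans
      (ih (τ M') (by omega) hM'.1 rfl K T F a hF hK)

end ProbTriple

/-! ### The program -/

local infixr:60 " ;; " => Cmd.seq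

/-- `x := y + z`. -/
abbrev Cmd.add (x y z : ℕ) : Cmd := .arith .add x y z

/-- `x := y - z`. -/
abbrev Cmd.sub (x y z : ℕ) : Cmd := .arith .sub x y z

/-- `x := y * z`. -/
abbrev Cmd.mul (x y z : ℕ) : Cmd := .arith .mul x y z

/-- `x := 1` if `y < z`, and `x := 0` otherwise. -/
abbrev Cmd.lt (x y z : ℕ) : Cmd := .arith .lt x y z

/-- Count the members of the set `reg 11` among the first `reg 8` entries of the array `2`. -/
def countCmd : Cmd :=
  -- Registers 12 and 2 hold the constants 0 and 1, so adding register 12 copies a register.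
  -- Register 13 counts down and 14 is the address.
  .const 17 0 ;; .const 14 0 ;; .add 13 8 12 ;;
  .loop 13 (.load 15 2 14 ;; .query 16 11 15 ;; .add 17 17 16 ;; .add 14 14 2 ;; .sub 13 13 2 ;;
    .skip) ;;
  .skip

/-- Remove the members of the set `reg 11` from the list of the first `reg len` entries of the
array `a`. -/
def filterCmd (a len : ℕ) : Cmd :=
  .const 17 0 ;; .const 14 0 ;; .add 13 len 12 ;;
  .loop 13 (.load 15 a 14 ;; .query 16 11 15 ;; .store a 17 15 ;; .sub 16 2 16 ;;
    .add 17 17 16 ;; .add 14 14 2 ;; .sub 13 13 2 ;; .skip) ;;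
  .add len 17 12 ;; .skip

/-- Choose the set `reg 11`: append it to the output and update the lists of uncovered elements. -/
def pickCmd : Cmd :=
  filterCmd 1 5 ;; filterCmd 2 8 ;; .store 0 6 11 ;; .add 6 6 2 ;; .skip

/-- Go through all sets and choose those with at least `reg 9` members among the uncovered
samples. -/
def passCmd : Cmd :=
  .const 11 0 ;; .add 10 1 12 ;;
  .loop 10 (countCmd ;; .lt 16 17 9 ;; .ite 16 .skip pickCmd ;; .add 11 11 2 ;; .sub 10 10 2 ;;
    .skip) ;;
  .skip

/-- Sample `reg 8` uncovered elements into the array `2`. -/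
def sampleCmd : Cmd :=
  -- `rand` includes its upper end, so register 16 must hold |U| - 1.
  (.const 14 0 ;; .add 13 8 12 ;; .sub 16 5 2 ;; .skip) ;;
  .loop 13 (.rand 15 16 ;; .load 15 1 15 ;; .store 2 14 15 ;; .add 14 14 2 ;; .sub 13 13 2 ;;
    .skip)

/-- Set the number of samples and the threshold. -/
def prepareCmd : Cmd :=
  .const 15 3 ;; .mul 9 15 3 ;; .add 8 9 9 ;; .mul 8 8 4 ;; .skip

/-- Double the guess if more than half of the samples are uncovered, and count the round. -/
def updateCmd : Cmd :=
  .add 15 8 8 ;; .add 16 9 9 ;; .mul 16 16 4 ;; .lt 15 16 15 ;; .add 15 15 2 ;; .mul 4 4 15 ;;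
  -- The product |U| · fuel is zero exactly when everything is covered or no rounds are left; it is
  -- the condition of the main loop.
  .sub 7 7 2 ;; .mul 18 5 7 ;; .skip

/-- One round. -/
def roundCmd : Cmd := (prepareCmd ;; sampleCmd) ;; passCmd ;; updateCmd

/-- Compute in register `3` the least `l` with `reg 0 + reg 1 ≤ 2 ^ l`. -/
def logCmd : Cmd :=
  .const 2 1 ;; .const 12 0 ;; .const 3 0 ;; .add 15 0 1 ;; .const 14 1 ;; .lt 16 14 15 ;;
  .loop 16 (.add 14 14 14 ;; .add 3 3 2 ;; .lt 16 14 15 ;; .skip) ;;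
  .skip

/-- List all elements in the array `1` and initialize the variables. -/
def startCmd : Cmd :=
  .const 14 0 ;; .add 13 0 12 ;;
  .loop 13 (.store 1 14 14 ;; .add 14 14 2 ;; .sub 13 13 2 ;; .skip) ;;
  .add 5 0 12 ;; .const 6 0 ;; .const 4 1 ;; .const 15 33 ;; .mul 7 15 3 ;; .mul 18 5 7 ;; .skip

/-- The algorithm. -/
def setCoverCmd : Cmd :=
  (logCmd ;; startCmd) ;; .loop 18 roundCmd ;; .add 0 6 12 ;; .skip

/-! ### Counting and filtering -/

theorem countCmd_spec {M : Mem} (h2 : M.reg 2 = 1) (h12 : M.reg 12 = 0)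
    (hlen : M.reg 8 < 2 ^ w) (hcell : ∀ j < M.reg 8, M.arr 2 j < 2 ^ w) (hw : 1 < 2 ^ w) :
    DetTriple w S countCmd M (20 * M.reg 8 + 20) fun M' =>
      M'.reg 17 = (M.list 2 (M.reg 8)).countP (fun x => answer S (M.reg 11) x ≠ 0) ∧
      M'.arr = M.arr ∧ ∀ x < 13, M'.reg x = M.reg x := by
  set l := M.reg 8 with hl
  set I : Mem → Prop := fun M' => ∃ i, M'.reg 14 = i ∧ M'.reg 13 + i = l ∧
    M'.reg 17 = (M.list 2 i).countP (fun x => answer S (M.reg 11) x ≠ 0) ∧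
    M'.arr = M.arr ∧ ∀ x < 13, M'.reg x = M.reg x with hI
  refine DetTriple.mono (DetTriple.const_seq (by omega) <| DetTriple.const_seq (by omega) <|
    DetTriple.arith_seq l (by simp [Op.eval, h12, hl]) hlen <|
    -- Eleven steps for the body and one for the loop test.
    DetTriple.seq (DetTriple.loop I (fun M' => 12 * M'.reg 13) ?_ ?_)
      fun M' h => DetTriple.skip h) ?_ ?_
  · rintro M' ⟨i, h14, h13, h17, harr, hreg⟩ hne
    have hle := List.countP_le_length (p := fun x => decide (answer S (M.reg 11) x ≠ 0))
      (l := M.list 2 i)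
    rw [Mem.length_list] at hle
    have hans := DetTriple.answer_le_one (S := S) (M.reg 11) (M.arr 2 i)
    refine ⟨11, DetTriple.load_seq (M.arr 2 i) (by rw [harr, h14]) (hcell i (by omega)) <|
      DetTriple.query_seq (M.reg 11) (M.arr 2 i) (by simp [hreg]) (by simp) hw <|
      DetTriple.arith_seq ((M.list 2 (i + 1)).countP (fun x => answer S (M.reg 11) x ≠ 0)) ?_ ?_ <|
      DetTriple.arith_seq (i + 1) (by simp [Op.eval, h14, hreg, h2]) (by omega) <|
      DetTriple.arith_seq (M'.reg 13 - 1) (by simp [Op.eval, hreg, h2]) (by omega) <|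
      DetTriple.skip ⟨⟨i + 1, by simp, by simp; omega, by simp, by simpa, ?_⟩, ?_⟩⟩
    · simp [Op.eval, h17, Mem.list_succ]
      split_ifs with h0 <;> omega
    · have := List.countP_le_length (p := fun x => decide (answer S (M.reg 11) x ≠ 0))
        (l := M.list 2 (i + 1))
      rw [Mem.length_list] at this
      omega
    · intro x hx
      have : x ≠ 13 ∧ x ≠ 14 ∧ x ≠ 15 ∧ x ≠ 16 ∧ x ≠ 17 := by omega
      simp [this, hreg x hx]
    · simp; omega
  · refine ⟨0, by simp, by simp, by simp, by simp, fun x hx => ?_⟩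
    have : x ≠ 13 ∧ x ≠ 14 ∧ x ≠ 17 := by omega
    simp [this]
  · simp; omega
  · rintro M' ⟨⟨i, h14, h13, h17, harr, hreg⟩, h0⟩
    obtain rfl : i = l := by omega
    exact ⟨h17, harr, hreg⟩

/-- In-place compaction: each entry is written at the write position (register 17), which advances
only if the entry is kept. It never overtakes the read position, so the unread cells are intact. -/
theorem filterCmd_spec {M : Mem} {a len : ℕ} (hlr : len = 5 ∨ len = 8) (h2 : M.reg 2 = 1)
    (h12 : M.reg 12 = 0) (hlen : M.reg len < 2 ^ w)
    (hcell : ∀ j < M.reg len, M.arr a j < 2 ^ w) (hw : 1 < 2 ^ w) :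
    DetTriple w S (filterCmd a len) M (20 * M.reg len + 20) fun M' =>
      M'.list a (M'.reg len) =
        (M.list a (M.reg len)).filter (fun x => answer S (M.reg 11) x = 0) ∧
      (∀ b ≠ a, M'.arr b = M.arr b) ∧ ∀ x < 13, x ≠ len → M'.reg x = M.reg x := by
  set l := M.reg len with hl
  set I : Mem → Prop := fun M' => ∃ i, M'.reg 14 = i ∧ M'.reg 13 + i = l ∧ M'.reg 17 ≤ i ∧
    M'.list a (M'.reg 17) = (M.list a i).filter (fun x => answer S (M.reg 11) x = 0) ∧
    (∀ j ≥ i, M'.arr a j = M.arr a j) ∧ (∀ b ≠ a, M'.arr b = M.arr b) ∧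
    ∀ x < 13, M'.reg x = M.reg x with hI
  have hlt : len < 13 := by omega
  refine DetTriple.mono (DetTriple.const_seq (by omega) <| DetTriple.const_seq (by omega) <|
    DetTriple.arith_seq l
      (by simp [Op.eval, h12, hl, show len ≠ 14 by omega, show len ≠ 17 by omega]) hlen <|
    DetTriple.seq (t₂ := 3) (DetTriple.loop I (fun M' => 16 * M'.reg 13) ?_ ?_)
      fun M' h => ?_) ?_ fun _ => id
  · rintro M' ⟨i, h14, h13, hle, hlist, hge, harr, hreg⟩ hne
    have hans := DetTriple.answer_le_one (S := S) (M.reg 11) (M.arr a i)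
    refine ⟨15, DetTriple.load_seq (M.arr a i) (by rw [h14, hge i le_rfl]) (hcell i (by omega)) <|
      DetTriple.query_seq (M.reg 11) (M.arr a i) (by simp [hreg]) (by simp) hw <|
      DetTriple.store_seq (M'.reg 17) (M.arr a i) (by simp) (by simp) (hcell i (by omega)) <|
      DetTriple.arith_seq (1 - answer S (M.reg 11) (M.arr a i)) (by simp [Op.eval, hreg, h2])
        (by omega) <|
      DetTriple.arith_seq (M'.reg 17 + (1 - answer S (M.reg 11) (M.arr a i))) (by simp [Op.eval])
        (by omega) <|
      DetTriple.arith_seq (i + 1) (by simp [Op.eval, h14, hreg, h2]) (by omega) <|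
      DetTriple.arith_seq (M'.reg 13 - 1) (by simp [Op.eval, hreg, h2]) (by omega) <|
      DetTriple.skip ⟨⟨i + 1, by simp, by simp; omega, by simp; omega, ?_, ?_, ?_, ?_⟩, ?_⟩⟩
    · rw [Mem.list_succ, List.filter_append, ← hlist]
      by_cases h0 : answer S (M.reg 11) (M.arr a i) = 0
      · simp only [Mem.put_reg, h0]
        simp only [↓reduceIte, List.filter_singleton, h0, decide_true, Nat.reduceEqDiff, tsub_zero]
        exact Mem.list_of_update (by simp)
      · have h1 : answer S (M.reg 11) (M.arr a i) = 1 := by omega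
        simp only [Mem.put_reg, h1]
        simp only [↓reduceIte, List.filter_singleton, h1, Nat.reduceEqDiff, tsub_self, add_zero]
        simp only [decide_false, cond_false, List.append_nil]
        exact Mem.list_congr fun j hj => by simp [Function.update_of_ne hj.ne]
    · intro j hj
      simp [Function.update_of_ne (show j ≠ M'.reg 17 by omega), hge j (by omega)]
    · intro b hb
      simp [Mem.putArr_arr_ne _ hb, harr b hb]
    · intro x hx
      have : x ≠ 13 ∧ x ≠ 14 ∧ x ≠ 15 ∧ x ≠ 16 ∧ x ≠ 17 := by omega
      simp [this, hreg x hx]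
    · simp; omega
  · refine ⟨0, by simp, by simp, by simp, by simp, by simp, by simp, fun x hx => ?_⟩
    have : x ≠ 13 ∧ x ≠ 14 ∧ x ≠ 17 := by omega
    simp [this]
  · obtain ⟨⟨i, h14, h13, hle, hlist, hge, harr, hreg⟩, h0⟩ := h
    obtain rfl : i = l := by omega
    refine DetTriple.arith_seq (M'.reg 17) (by simp [Op.eval, hreg, h12]) (by omega) <|
      DetTriple.skip ⟨?_, ?_, ?_⟩
    · simpa using hlist
    · simpa using harr
    · intro x hx hne
      simp [hne, hreg x hx]
  · simp; omega

/-! ### The state of the algorithm -/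

/-- The members of `l` that no set with index in `T` contains. -/
def uncovered (S : Fin m → Finset (Fin n)) (T l : List ℕ) : List ℕ :=
  l.filter fun x => ∀ s ∈ T, answer S s x = 0

theorem mem_uncovered {T l : List ℕ} {x : ℕ} :
    x ∈ uncovered S T l ↔ x ∈ l ∧ ∀ s ∈ T, answer S s x = 0 := by
  simp [uncovered]

@[simp] theorem uncovered_nil (l : List ℕ) : uncovered S [] l = l := by
  simp [uncovered]

theorem uncovered_append (T T' l : List ℕ) :
    uncovered S (T ++ T') l = uncovered S T' (uncovered S T l) := by
  simp only [uncovered, List.filter_filter, List.mem_append]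
  refine List.filter_congr fun x _ => ?_
  rw [Bool.eq_iff_iff]
  simp only [Bool.and_eq_true, decide_eq_true_eq, List.mem_append]
  constructor
  · exact fun h => ⟨fun s hs => h s (.inr hs), fun s hs => h s (.inl hs)⟩
  · rintro ⟨h₁, h₂⟩ s (hs | hs)
    · exact h₂ s hs
    · exact h₁ s hs

theorem uncovered_singleton (s : ℕ) (l : List ℕ) :
    uncovered S [s] l = l.filter fun x => answer S s x = 0 := by
  simp [uncovered]

/-- The number of members of `l` that the set with index `s` contains. -/
def hitCount (S : Fin m → Finset (Fin n)) (s : ℕ) (l : List ℕ) : ℕ :=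
  l.countP fun x => answer S s x ≠ 0

theorem hitCount_add_length (s : ℕ) (l : List ℕ) :
    hitCount S s l + (uncovered S [s] l).length = l.length := by
  rw [uncovered_singleton, ← List.countP_eq_length_filter, hitCount, add_comm,
    List.length_eq_countP_add_countP (fun x => decide (answer S s x = 0))]
  simp

theorem hitCount_uncovered_singleton (s : ℕ) (l : List ℕ) :
    hitCount S s (uncovered S [s] l) = 0 := by
  simp [hitCount, uncovered]

/-- This monotonicity is why a single pass suffices: a set rejected once stays below the threshold.
-/
theorem hitCount_uncovered_le (s : ℕ) (T l : List ℕ) :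
    hitCount S s (uncovered S T l) ≤ hitCount S s l :=
  List.Sublist.countP_le List.filter_sublist

theorem length_uncovered_le (T l : List ℕ) : (uncovered S T l).length ≤ l.length :=
  List.length_filter_le _ _

/-- The memory `M` holds the number `L`, the guess `g`, the number `fuel` of remaining rounds, the
output `out`, the list `U` of uncovered elements, the list `R` of uncovered samples, and the
constants. -/
structure Holds (S : Fin m → Finset (Fin n)) (L g fuel τ : ℕ) (out U R : List ℕ) (M : Mem) :
    Prop where
  reg0 : M.reg 0 = n
  reg1 : M.reg 1 = m
  reg2 : M.reg 2 = 1
  reg3 : M.reg 3 = L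
  reg4 : M.reg 4 = g
  reg5 : M.reg 5 = U.length
  reg6 : M.reg 6 = out.length
  reg7 : M.reg 7 = fuel
  reg8 : M.reg 8 = R.length
  reg9 : M.reg 9 = τ
  reg12 : M.reg 12 = 0
  list0 : M.list 0 out.length = out
  list1 : M.list 1 U.length = U
  list2 : M.list 2 R.length = R

theorem length_le_of_nodup {l : List ℕ} {N : ℕ} (h : l.Nodup) (hl : ∀ x ∈ l, x < N) :
    l.length ≤ N := by
  have := List.Nodup.length_le_card (α := Fin N) (l := l.attach.map fun x => ⟨x.1, hl x.1 x.2⟩)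
    (List.Nodup.map (fun a b hab => Subtype.ext (by simpa using hab)) (List.nodup_attach.mpr h))
  simpa using this

theorem filterCmd_spec_list {M : Mem} {a len : ℕ} {l : List ℕ} (hlr : len = 5 ∨ len = 8)
    (h2 : M.reg 2 = 1) (h12 : M.reg 12 = 0) (hlen : l.length < 2 ^ w) (hl : ∀ x ∈ l, x < 2 ^ w)
    (hw : 1 < 2 ^ w) (hreg : M.reg len = l.length) (hlist : M.list a l.length = l) :
    DetTriple w S (filterCmd a len) M (20 * l.length + 20) fun M' =>
      M'.reg len = (uncovered S [M.reg 11] l).length ∧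
      M'.list a (uncovered S [M.reg 11] l).length = uncovered S [M.reg 11] l ∧
      (∀ b ≠ a, M'.arr b = M.arr b) ∧ ∀ x < 13, x ≠ len → M'.reg x = M.reg x := by
  refine (filterCmd_spec hlr h2 h12 (by rwa [hreg]) (fun j hj => ?_) hw).mono
    (by rw [hreg]) fun M' ⟨h₁, h₂⟩ => ?_
  · exact hl _ (by rw [← hlist]; exact M.arr_mem_list (by rwa [← hreg]))
  · rw [hreg, hlist, ← uncovered_singleton] at h₁
    have : M'.reg len = (uncovered S [M.reg 11] l).length := by rw [← h₁, Mem.length_list]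
    rw [← this]
    exact ⟨rfl, h₁, h₂⟩

theorem Mem.list_eq_of_arr {M M' : Mem} {a : ℕ} (h : M'.arr a = M.arr a) (l : ℕ) :
    M'.list a l = M.list a l :=
  Mem.list_congr fun _ _ => by rw [h]

theorem pickCmd_spec {L g fuel τ : ℕ} {out U R : List ℕ} {M : Mem}
    (h : Holds S L g fuel τ out U R M) (hn : n < 2 ^ w) (hw : 1 < 2 ^ w)
    (hU : ∀ x ∈ U, x < n) (hR : ∀ x ∈ R, x < n) (hUl : U.length < 2 ^ w)
    (hRl : R.length < 2 ^ w) (hout : out.length + 1 < 2 ^ w) (hs : M.reg 11 < 2 ^ w) :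
    DetTriple w S pickCmd M (20 * U.length + 20 * R.length + 50) fun M' =>
      Holds S L g fuel τ (out ++ [M.reg 11]) (uncovered S [M.reg 11] U)
        (uncovered S [M.reg 11] R) M' ∧ M'.reg 10 = M.reg 10 ∧ M'.reg 11 = M.reg 11 := by
  refine DetTriple.mono (DetTriple.seq (filterCmd_spec_list (Or.inl rfl) h.reg2 h.reg12 hUl
      (fun x hx => (hU x hx).trans hn) hw h.reg5 h.list1)
      (t₂ := 20 * R.length + 20 + 5 + 1) ?_) (by omega) fun _ => id
  rintro M₁ ⟨h5, hl1, harr₁, hreg₁⟩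
  refine DetTriple.mono (DetTriple.seq (t₂ := 5) (filterCmd_spec_list (M := M₁) (l := R) (Or.inr rfl) (by simp [hreg₁, h.reg2])
    (by simp [hreg₁, h.reg12]) hRl (fun x hx => (hR x hx).trans hn) hw
    (by simp [hreg₁, h.reg8]) (by rw [Mem.list_eq_of_arr (harr₁ 2 (by simp)), h.list2])) ?_)
    (by omega) fun _ => id
  rintro M₂ ⟨h8, hl2, harr₂, hreg₂⟩
  have e11 : M₁.reg 11 = M.reg 11 := hreg₁ 11 (by simp) (by simp)
  rw [e11] at h8 hl2
  have hreg : ∀ x < 13, x ≠ 5 → x ≠ 8 → M₂.reg x = M.reg x := fun x hx h5 h8 => by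
    rw [hreg₂ x hx h8, hreg₁ x hx h5]
  have hl1' : M₂.list 1 (uncovered S [M.reg 11] U).length = uncovered S [M.reg 11] U := by
    rw [Mem.list_eq_of_arr (harr₂ 1 (by simp)), hl1]
  have hl0 : M₂.arr 0 = M.arr 0 := by rw [harr₂ 0 (by simp), harr₁ 0 (by simp)]
  refine DetTriple.store_seq out.length (M.reg 11) (by simp [hreg, h.reg6]) (by simp [hreg]) hs <|
    DetTriple.arith_seq (out.length + 1) (by simp [Op.eval, hreg, h.reg6, h.reg2]) hout <|
    DetTriple.skip ⟨?_, by simp [hreg], by simp [hreg]⟩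
  constructor
  any_goals simp [hreg, h.reg0, h.reg1, h.reg2, h.reg3, h.reg4, h.reg7, h.reg9, h.reg12]
  · rw [hreg₂ 5 (by simp) (by simp), h5]
  · exact h8
  · rw [Mem.list_of_update (M := M₂) (v := M.reg 11) (by simp), Mem.list_eq_of_arr hl0, h.list0]
  · rw [Mem.putArr_list_ne _ (by simp), hl1']
  · rw [Mem.putArr_list_ne _ (by simp), hl2]

theorem Holds.congr {L g fuel τ : ℕ} {out U R : List ℕ} {M M' : Mem}
    (h : Holds S L g fuel τ out U R M) (harr : M'.arr = M.arr)
    (hreg : ∀ x ∈ [0, 1, 2, 3, 4, 5, 6, 7, 8, 9, 12], M'.reg x = M.reg x) :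
    Holds S L g fuel τ out U R M' := by
  have hl : ∀ a l, M'.list a l = M.list a l := fun a l => Mem.list_eq_of_arr (by rw [harr]) l
  constructor <;> simp only [hl, hreg, List.mem_cons, true_or, or_true, h.reg0, h.reg1, h.reg2,
    h.reg3, h.reg4, h.reg5, h.reg6, h.reg7, h.reg8, h.reg9, h.reg12, h.list0, h.list1, h.list2]

/-- Each chosen set uses up at least τ samples, which gives both the bound on the number of choices
and the time: one count per set, and one costly filtering per choice, at most |R| / τ times. -/
theorem passCmd_spec {L g fuel τ : ℕ} {out R : List ℕ} {M : Mem}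
    (h : Holds S L g fuel τ out (uncovered S out (List.range n)) R M) (hτ : 0 < τ)
    (hR : ∀ x ∈ R, x ∈ uncovered S out (List.range n)) (hnd : out.Nodup)
    (hout : ∀ s ∈ out, s < m) (hn : n < 2 ^ w) (hm : m + 1 < 2 ^ w) (hw : 1 < 2 ^ w)
    (hRl : R.length < 2 ^ w) :
    DetTriple w S passCmd M
      (m * (20 * R.length + 50) + R.length / τ * (20 * n + 20 * R.length + 50) + 10) fun M' =>
      ∃ T : List ℕ, Holds S L g fuel τ (out ++ T) (uncovered S (out ++ T) (List.range n))
          (uncovered S T R) M' ∧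
        (out ++ T).Nodup ∧ (∀ s ∈ T, s < m) ∧
        T.length * τ + (uncovered S T R).length ≤ R.length ∧
        ∀ s < m, hitCount S s (uncovered S T R) < τ := by
  set A := 20 * R.length + 50 with hA
  set B := 20 * n + 20 * R.length + 50 with hB
  set I : Mem → Prop := fun M' => ∃ (T : List ℕ) (c : ℕ),
    Holds S L g fuel τ (out ++ T) (uncovered S (out ++ T) (List.range n)) (uncovered S T R) M' ∧
        (out ++ T).Nodup ∧ (∀ s ∈ T, s < m) ∧
        T.length * τ + (uncovered S T R).length ≤ R.length ∧
        M'.reg 11 = c ∧ M'.reg 10 + c = m ∧ ∀ s < c, hitCount S s (uncovered S T R) < τ with hI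
  refine DetTriple.mono (DetTriple.const_seq (by omega) <|
    DetTriple.arith_seq m (by simp [Op.eval, h.reg1, h.reg12]) (by omega) <|
    -- Each unvisited set pays `A` for counting. The quotient |R| / τ drops by at least one at each
    -- choice, which pays `B` for filtering.
    DetTriple.seq (DetTriple.loop I (fun M' => M'.reg 10 * A + M'.reg 8 / τ * B) ?_ ?_)
      fun M' h => DetTriple.skip h) ?_ ?_
  · rintro M' ⟨T, c, hH, hnd', hT, hlen, h11, h10, hlt⟩ hne
    have hRT : (uncovered S T R).length ≤ R.length := length_uncovered_le _ _
    have hmemn : ∀ x ∈ uncovered S T R, x < n := fun x hx => by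
      simpa using (mem_uncovered.mp (hR x (mem_uncovered.mp hx).1)).1
    have hT' : ∀ s ∈ out ++ T, s < m := by
      intro s hs
      rcases List.mem_append.mp hs with hs | hs
      exacts [hout s hs, hT s hs]
    have hleno : (out ++ T).length ≤ m := length_le_of_nodup hnd' hT'
    have hlenU : (uncovered S (out ++ T) (List.range n)).length ≤ n :=
      (length_uncovered_le _ _).trans (by simp)
    have hcount := countCmd_spec (w := w) (S := S) hH.reg2 hH.reg12 (by rw [hH.reg8]; omega)
      (by
        rw [hH.reg8]
        intro j hj
        exact (hmemn _ (by rw [← hH.list2]; exact M'.arr_mem_list hj)).trans hn) hw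
    rw [hH.reg8, hH.list2, h11] at hcount
    set b := τ ≤ hitCount S c (uncovered S T R) with hb
    refine ⟨20 * (uncovered S T R).length + 20 + ((if b then 20 * n + 20 *
        (uncovered S T R).length + 50 else 1) + 1 + 5 + 1 + 2) + 1, DetTriple.seq hcount ?_⟩
    rintro M₁ ⟨h17, harr, hreg⟩
    have hH₁ := hH.congr harr (M' := M₁) fun x hx => hreg x (by fin_cases hx <;> simp)
    refine DetTriple.arith_seq (if b then 0 else 1) ?_ (by split_ifs <;> omega) ?_
    · simp only [Op.eval, h17, hreg 9 (by simp), hH.reg9, hb]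
      rw [← hitCount]
      split_ifs <;> omega
    have hH₂ : ∀ v, Holds S L g fuel τ (out ++ T) (uncovered S (out ++ T) (List.range n))
        (uncovered S T R) (M₁.put 16 v) := fun v => hH₁.congr (by simp) (by simp)
    set I' : Mem → Prop := fun M' => ∃ T : List ℕ,
      Holds S L g fuel τ (out ++ T) (uncovered S (out ++ T) (List.range n)) (uncovered S T R) M' ∧
        (out ++ T).Nodup ∧ (∀ s ∈ T, s < m) ∧
        T.length * τ + (uncovered S T R).length ≤ R.length ∧
        M'.reg 11 = c ∧ M'.reg 10 + c = m ∧ ∀ s < c + 1, hitCount S s (uncovered S T R) < τ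
    refine DetTriple.seq (R := fun M₂ => I' M₂ ∧ M₂.reg 10 = M'.reg 10 ∧
      (if b then 1 else 0) + M₂.reg 8 / τ ≤ M'.reg 8 / τ) (t₂ := 5) (DetTriple.ite ?_ ?_) ?_
    · intro hx
      have hb' : ¬ b := by simpa using hx
      rw [if_neg hb', if_neg hb']
      refine DetTriple.skip ?_
      refine ⟨⟨T, hH₂ _, hnd', hT, hlen, by simp [hreg, h11], by simp [hreg, h10],
        fun s hs => ?_⟩, by simp [hreg], by simp [hreg, hb']⟩
      rcases Nat.lt_succ_iff_lt_or_eq.mp hs with hs | rfl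
      exacts [hlt s hs, not_le.mp hb']
    · intro hx
      have hb' : b := by simpa using hx
      have hcm : c < m := by omega
      rw [if_pos hb', if_pos hb']
      refine (pickCmd_spec (hH₂ _) hn hw (fun x hx => by simpa using (mem_uncovered.mp hx).1) hmemn
        (by omega) (by omega) (by omega) (by simp [hreg, h11]; omega)).mono (by omega) ?_
      have e11 : (M₁.put 16 (if b then 0 else 1)).reg 11 = c := by simp [hreg, h11]
      have e10 : (M₁.put 16 (if b then 0 else 1)).reg 10 = M'.reg 10 := by simp [hreg]
      rw [if_pos hb'] at e11 e10
      rw [e11, e10]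
      rintro M₂ ⟨hH₃, h10', h11'⟩
      rw [← uncovered_append, ← uncovered_append, List.append_assoc] at hH₃
      have hcl := hitCount_add_length (S := S) c (uncovered S T R)
      rw [← uncovered_append] at hcl
      have hτc : τ ≤ hitCount S c (uncovered S T R) := hb'
      refine ⟨⟨T ++ [c], hH₃, ?_, ?_, ?_, h11', by rw [h10', h10], ?_⟩, h10', ?_⟩
      · rw [← List.append_assoc]
        refine List.Nodup.append hnd' (by simp) ?_
        simp only [List.disjoint_singleton]
        intro hc
        -- Since 0 < τ, the set `c` contains an uncovered sample, so it cannot have been chosen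
        -- before.
        obtain ⟨x, hx, hx'⟩ := List.countP_pos_iff.mp (hτ.trans_le hτc)
        rcases List.mem_append.mp hc with hc | hc
        · exact absurd ((mem_uncovered.mp (hR x (mem_uncovered.mp hx).1)).2 c hc) (by simpa using hx')
        · exact absurd ((mem_uncovered.mp hx).2 c hc) (by simpa using hx')
      · intro s hs
        rcases List.mem_append.mp hs with hs | hs
        · exact hT s hs
        · obtain rfl := List.mem_singleton.mp hs
          exact hcm
      · rw [List.length_append, List.length_singleton, add_mul, one_mul]
        omega
      · intro s hs
        rw [uncovered_append]
        rcases Nat.lt_succ_iff_lt_or_eq.mp hs with hs | rfl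
        · exact (hitCount_uncovered_le _ _ _).trans_lt (hlt s hs)
        · rwa [hitCount_uncovered_singleton]
      · rw [hH₃.reg8, hH.reg8, if_pos hb', add_comm, ← Nat.add_div_right _ hτ]
        exact Nat.div_le_div_right (by omega)
    · rintro M₂ ⟨⟨T', hH', hnd'', hT'', hlen', h11', h10', hlt'⟩, h10'', hdiv⟩
      refine DetTriple.arith_seq (c + 1) (by simp [Op.eval, h11', hH'.reg2]) (by omega) <|
        DetTriple.arith_seq (M'.reg 10 - 1) (by simp [Op.eval, h10'', hH'.reg2]) (by omega) <|
        DetTriple.skip ⟨⟨T', c + 1, hH'.congr (by simp) (by simp), hnd'', hT'', hlen', by simp,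
          by simp; omega, hlt'⟩, ?_⟩
      simp only [Mem.put_reg]
      simp only [↓reduceIte, Nat.reduceEqDiff]
      obtain ⟨e, he⟩ := Nat.exists_eq_add_of_lt (Nat.pos_of_ne_zero hne)
      rw [he, show 0 + e + 1 - 1 = e by omega, show (0 + e + 1) * A = e * A + A by ring]
      have := Nat.mul_le_mul_right B hdiv
      rw [add_mul] at this
      split_ifs at this ⊢ <;> omega
  · refine ⟨[], 0, ?_, by simpa, by simp, by simp, by simp, by simp, by simp⟩
    simp only [List.append_nil, uncovered_nil]
    exact h.congr (by simp) (by simp)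
  · simp [h.reg8]
  · rintro M' ⟨⟨T, c, hH, hnd', hT, hlen, h11, h10, hlt⟩, h0⟩
    obtain rfl : c = m := by omega
    exact ⟨T, hH, hnd', hT, hlen, hlt⟩

/-! ### Sampling -/

/-- The sample `R` misrepresents `U`: at most `j` sets cover half of `R`, but less than a
sixteenth of `U`. -/
def Misleading (S : Fin m → Finset (Fin n)) (j : ℕ) (U R : List ℕ) : Prop :=
  ∃ T : List ℕ, T.length ≤ j ∧ (∀ s ∈ T, s < m) ∧
    2 * (uncovered S T R).length ≤ R.length ∧ 15 * U.length < 16 * (uncovered S T U).length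

/-- The number of entries of `l` that one of the sets `T i` contains. -/
def coverCount {j : ℕ} (S : Fin m → Finset (Fin n)) (T : Fin j → Fin m) (l : List ℕ) : ℕ :=
  l.countP fun x => ∃ i, answer S (T i) x ≠ 0

/-- The families of `j` sets that cover at most a sixteenth of `U`. -/
def lightFamilies (S : Fin m → Finset (Fin n)) (j : ℕ) (U : List ℕ) : Finset (Fin j → Fin m) :=
  {T | 16 * coverCount S T U ≤ U.length}

/-- The exponential potential of a sample. -/
def potential (S : Fin m → Finset (Fin n)) (j : ℕ) (U R : List ℕ) : ℕ :=
  ∑ T ∈ lightFamilies S j U, 16 ^ coverCount S T R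

/-- Appending a covered element multiplies the power by 16, an uncovered one leaves it unchanged. -/
theorem sum_pow_coverCount {j : ℕ} (T : Fin j → Fin m) (U R : List ℕ) :
    (U.map fun x => 16 ^ coverCount S T (R ++ [x])).sum =
      16 ^ coverCount S T R * (U.length + 15 * coverCount S T U) := by
  induction U with
  | nil => simp [coverCount]
  | cons x U ih =>
    rw [List.map_cons, List.sum_cons, ih]
    simp only [coverCount, List.countP_append, List.countP_cons, List.countP_nil, List.length_cons]
    split_ifs <;> ring

/-- For a light family the mean growth factor is at most 1 + 15/16 ≤ 2, so one uniform draw from `U`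
at most doubles the expected potential. -/
theorem sum_potential_le (j : ℕ) (U R : List ℕ) :
    (U.map fun x => potential S j U (R ++ [x])).sum ≤ 2 * U.length * potential S j U R := by
  have : (U.map fun x => potential S j U (R ++ [x])).sum =
      ∑ T ∈ lightFamilies S j U, (U.map fun x => 16 ^ coverCount S T (R ++ [x])).sum := by
    simp only [potential]
    generalize lightFamilies S j U = s
    induction U with
    | nil => simp
    | cons x U ih => simp only [List.map_cons, List.sum_cons, ih, Finset.sum_add_distrib]
  rw [this, potential, Finset.mul_sum]
  refine Finset.sum_le_sum fun T hT => ?_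
  rw [sum_pow_coverCount, mul_comm]
  have : 16 * coverCount S T U ≤ U.length := by simpa [lightFamilies] using hT
  exact Nat.mul_le_mul_right _ (by omega)

theorem potential_nil_le (j : ℕ) (U : List ℕ) : potential S j U [] ≤ m ^ j := by
  simp only [potential, coverCount, List.countP_nil, pow_zero, Finset.sum_const, smul_eq_mul,
    mul_one]
  exact (Finset.card_le_univ _).trans (by simp)

theorem coverCount_add_length {j : ℕ} {T : Fin j → Fin m} {T' : List ℕ}
    (h : ∀ s, s ∈ T' ↔ ∃ i, (T i : ℕ) = s) (l : List ℕ) :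
    coverCount S T l + (uncovered S T' l).length = l.length := by
  rw [uncovered, ← List.countP_eq_length_filter, coverCount,
    List.length_eq_countP_add_countP (fun x => decide (∃ i, answer S (T i) x ≠ 0))]
  congr 1
  refine List.countP_congr fun x _ => ?_
  simp [h]

/-- The sets that witness `Misleading` form a light family covering at least half of `R`; its term
alone is at least 16^(|R|/2) = 4^|R|. -/
theorem pow_le_potential {j : ℕ} {U R : List ℕ} (hR : R ≠ []) (h : Misleading S j U R) :
    4 ^ R.length ≤ potential S j U R := by
  obtain ⟨T', hlen, hm, hR', hU⟩ := h
  have hne : T' ≠ [] := by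
    rintro rfl
    have := List.length_pos_iff.mpr hR
    rw [uncovered_nil] at hR'
    omega
  have hpos := List.length_pos_iff.mpr hne
  -- The list is padded to length exactly `j` with its own first entry, which does not change its
  -- union. It is nonempty because `R` is.
  let T : Fin j → Fin m := fun i => ⟨T'.getD i T'[0], by
    rw [List.getD_eq_getElem?_getD]
    by_cases hi : i < T'.length
    · simpa [hi] using hm _ (List.getElem_mem hi)
    · simpa [hi] using hm _ (List.getElem_mem hpos)⟩
  have hT : ∀ s, s ∈ T' ↔ ∃ i, (T i : ℕ) = s := by
    intro s
    constructor
    · intro hs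
      obtain ⟨i, hi, rfl⟩ := List.getElem_of_mem hs
      exact ⟨⟨i, hi.trans_le hlen⟩, by simp [T, hi]⟩
    · rintro ⟨i, rfl⟩
      by_cases hi : i < T'.length
      · simp [T, hi]
      · simp [T, hi]
  have hcR := coverCount_add_length (S := S) hT R
  have hcU := coverCount_add_length (S := S) hT U
  calc 4 ^ R.length ≤ 4 ^ (2 * coverCount S T R) := Nat.pow_le_pow_right (by simp) (by omega)
    _ = 16 ^ coverCount S T R := by rw [pow_mul]; norm_num
    _ ≤ _ := Finset.single_le_sum (f := fun T => 16 ^ coverCount S T R) (fun _ _ => by simp)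
        (by simp only [lightFamilies, Finset.mem_filter_univ]; omega)

-- The function `φ` is the potential of the samples drawn so far times 2^(remaining draws) / 4^r. It
-- does not increase in expectation, starts at no more than m^j · 2^r / 4^r, and at the end
-- dominates the indicator of a misleading sample.
open Classical in
theorem sampleCmd_spec {j r : ℕ} {U : List ℕ} {M : Mem} (h1 : M.list 1 U.length = U)
    (h2 : M.reg 2 = 1) (h5 : M.reg 5 = U.length) (h8 : M.reg 8 = r) (h12 : M.reg 12 = 0)
    (hU0 : U ≠ []) (hU : ∀ x ∈ U, x < 2 ^ w) (hUl : U.length < 2 ^ w) (hr0 : 0 < r)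
    (hr : r < 2 ^ w) :
    ProbTriple w S sampleCmd M (12 * r + 20)
      (fun M' => (∀ x ∈ M'.list 2 r, x ∈ U) ∧ M'.arr 0 = M.arr 0 ∧ M'.arr 1 = M.arr 1 ∧
        ∀ x < 13, M'.reg x = M.reg x)
      (fun M' => if Misleading S j U (M'.list 2 r) then 1 else 0) (m ^ j * (2 ^ r)⁻¹) := by
  set I : Mem → Prop := fun M' => ∃ i, M'.reg 14 = i ∧ M'.reg 13 + i = r ∧
    M'.reg 16 = U.length - 1 ∧ (∀ x ∈ M'.list 2 i, x ∈ U) ∧ M'.arr 0 = M.arr 0 ∧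
    M'.arr 1 = M.arr 1 ∧ ∀ x < 13, M'.reg x = M.reg x with hI
  have hpos := List.length_pos_iff.mpr hU0
  let φ : Mem → ℝ≥0∞ := fun M' =>
    potential S j U (M'.list 2 (M'.reg 14)) * (2 ^ M'.reg 13 * (4 ^ r)⁻¹)
  have hinit : DetTriple w S (.seq (.const 14 0) (.seq (.add 13 8 12) (.seq (.sub 16 5 2) .skip)))
      M 7 fun M' => I M' ∧ M'.reg 13 = r ∧ M'.reg 14 = 0 := by
    refine DetTriple.const_seq (by omega) <|
      DetTriple.arith_seq r (by simp [Op.eval, h8, h12]) hr <|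
      DetTriple.arith_seq (U.length - 1) (by simp [Op.eval, h5, h2]) (by omega) <|
      DetTriple.skip ⟨⟨0, by simp, by simp, by simp, by simp, by simp, by simp, fun x hx => ?_⟩,
        by simp, by simp⟩
    have : x ≠ 13 ∧ x ≠ 14 ∧ x ≠ 16 := by omega
    simp [this]
  have hbody : ∀ M', I M' → M'.reg 13 ≠ 0 → ∃ t ≤ 12 * M'.reg 13,
      ProbTriple w S (.seq (.rand 15 16) (.seq (.load 15 1 15)
        (.seq (.store 2 14 15) (.seq (.add 14 14 2) (.seq (.sub 13 13 2) .skip))))) M' t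
        (fun M'' => I M'' ∧ t + 1 + 12 * M''.reg 13 ≤ 12 * M'.reg 13) φ (φ M') := by
    rintro M' ⟨i, h14, h13, h16, hlist, harr0, harr1, hreg⟩ hne
    refine ⟨11, by omega, ProbTriple.rand_seq (t := 9) (u := U.length) (by omega) hUl.le
      (f' := fun y => potential S j U (M'.list 2 i ++ [M.arr 1 y]) *
        (2 ^ (M'.reg 13 - 1) * (4 ^ r)⁻¹)) (fun y hy => ProbTriple.of_det ?_) ?_⟩
    · have hyU : M.arr 1 y ∈ U := by rw [← h1]; exact M.arr_mem_list hy
      refine DetTriple.load_seq (M.arr 1 y) (by simp [harr1]) (hU _ hyU) <|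
        DetTriple.store_seq i (M.arr 1 y) (by simp [h14]) (by simp) (hU _ hyU) <|
        DetTriple.arith_seq (i + 1) (by simp [Op.eval, h14, hreg, h2]) (by omega) <|
        DetTriple.arith_seq (M'.reg 13 - 1) (by simp [Op.eval, hreg, h2]) (by omega) <|
        DetTriple.skip ⟨⟨⟨i + 1, by simp, by simp; omega, by simp [h16], ?_, ?_, ?_, ?_⟩, ?_⟩, ?_⟩
      · rw [Mem.put_list, Mem.put_list, Mem.list_of_update (M := M') (v := M.arr 1 y) (by simp)]
        intro x hx
        rcases List.mem_append.mp hx with hx | hx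
        · exact hlist x hx
        · rwa [List.mem_singleton.mp hx]
      · simp [Mem.putArr_arr_ne, harr0]
      · simp [Mem.putArr_arr_ne, harr1]
      · intro x hx
        have : x ≠ 13 ∧ x ≠ 14 ∧ x ≠ 15 ∧ x ≠ 16 := by omega
        simp [this, hreg x hx]
      · simp; omega
      · simp only [φ, Mem.put_list, Mem.put_reg]
        simp only [↓reduceIte, Nat.reduceEqDiff]
        rw [Mem.list_of_update (M := M') (v := M.arr 1 y) (by simp)]
    · have hsum : ∑ y ∈ Finset.range U.length, potential S j U (M'.list 2 i ++ [M.arr 1 y]) ≤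
          2 * U.length * potential S j U (M'.list 2 i) := by
        refine le_of_eq_of_le ?_ (sum_potential_le j U (M'.list 2 i))
        conv_rhs => rw [show (U.map fun x => potential S j U (M'.list 2 i ++ [x])) =
          (M.list 1 U.length).map fun x => potential S j U (M'.list 2 i ++ [x]) by rw [h1]]
        rw [show M.list 1 U.length = (List.range U.length).map (M.arr 1) from rfl, List.map_map]
        rfl
      obtain ⟨e, he⟩ := Nat.exists_eq_add_of_lt (Nat.pos_of_ne_zero hne)
      rw [zero_add] at he
      refine ENNReal.div_le_of_le_mul ?_
      simp only [φ, h14, he, Nat.add_sub_cancel]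
      rw [← Finset.sum_mul, ← Nat.cast_sum]
      calc _ ≤ ((2 * U.length * potential S j U (M'.list 2 i) : ℕ) : ℝ≥0∞) *
            (2 ^ e * (4 ^ r)⁻¹) := by gcongr
        _ = _ := by push_cast; ring
  refine (ProbTriple.seq (t₂ := 12 * r + 1)
    (R := fun M' => I M' ∧ M'.reg 13 = r ∧ M'.reg 14 = 0) (g := φ) (b := m ^ j * (2 ^ r)⁻¹)
    (ProbTriple.of_det (hinit.mono le_rfl fun M' h => ⟨h, ?_⟩)) fun M₁ hM₁ =>
    (ProbTriple.loop I (fun M' => 12 * M'.reg 13) φ hbody hM₁.1).mono (by rw [hM₁.2.1])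
      (fun _ => id) (fun _ _ => le_rfl) (le_refl (φ M₁))).mono ?_ ?_ ?_ le_rfl
  · simp only [φ, h.2.1, h.2.2, Mem.list_zero]
    rw [← mul_assoc, mul_comm _ (2 ^ r), mul_comm (2 ^ r), mul_assoc]
    gcongr
    · exact_mod_cast potential_nil_le j U
    · rw [show (4 : ℝ≥0∞) = 2 * 2 by norm_num, mul_pow, ENNReal.mul_inv (by simp) (by simp),
        ← mul_assoc, ENNReal.mul_inv_cancel (by simp) (by simp), one_mul]
  · omega
  · rintro M' ⟨⟨i, h14, h13, h16, hlist, harr0, harr1, hreg⟩, h0⟩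
    obtain rfl : i = r := by omega
    exact ⟨hlist, harr0, harr1, hreg⟩
  · rintro M' ⟨⟨i, h14, h13, h16, hlist, harr0, harr1, hreg⟩, h0⟩
    obtain rfl : i = r := by omega
    split_ifs with hmis
    · simp only [φ, h14, h0, pow_zero, one_mul]
      have hne : M'.list 2 i ≠ [] := by
        rw [← List.length_pos_iff]; simpa
      have := pow_le_potential hne hmis
      rw [Mem.length_list] at this
      rw [← div_eq_mul_inv, ENNReal.le_div_iff_mul_le (by simp) (by simp), one_mul]
      exact_mod_cast this
    · exact zero_le

/-! ### One round -/

theorem answer_ne_zero_iff (s : Fin m) (x : Fin n) : answer S s x ≠ 0 ↔ x ∈ S s := by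
  simp [answer]

theorem length_le_sum_hitCount {T : Finset (Fin m)} (hT : IsCover S T) {l : List ℕ}
    (hl : ∀ x ∈ l, x < n) : l.length ≤ ∑ s ∈ T, hitCount S s l := by
  induction l with
  | nil => simp
  | cons x l ih =>
    have hx := hl x (by simp)
    obtain ⟨s, hs, hxs⟩ := hT ⟨x, hx⟩
    have hone : 1 ≤ ∑ s ∈ T, if answer S s x ≠ 0 then 1 else 0 := by
      refine le_trans ?_ (Finset.single_le_sum (fun _ _ => by simp) hs)
      rw [if_pos ((answer_ne_zero_iff s ⟨x, hx⟩).mpr hxs)]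
    have := ih fun y hy => hl y (by simp [hy])
    simp only [hitCount, List.countP_cons, Finset.sum_add_distrib, List.length_cons,
      decide_eq_true_eq] at *
    omega

theorem IsMinCoverSize.le_card {k : ℕ} (hk : IsMinCoverSize S k) : k ≤ n := by
  classical
  obtain ⟨⟨T, hT, -⟩, hmin⟩ := hk
  choose f hf hf' using hT
  refine (hmin ⟨Finset.univ.image f, fun x => ⟨f x, by simp, hf' x⟩, rfl⟩).trans ?_
  exact Finset.card_image_le.trans (by simp)

theorem IsMinCoverSize.le_sets {k : ℕ} (hk : IsMinCoverSize S k) : k ≤ m := by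
  obtain ⟨⟨T, -, rfl⟩, -⟩ := hk
  simpa using Finset.card_le_univ T

theorem IsMinCoverSize.pos {k : ℕ} (hk : IsMinCoverSize S k) (hn : 0 < n) : 0 < k := by
  obtain ⟨⟨T, hT, rfl⟩, -⟩ := hk
  obtain ⟨s, hs, -⟩ := hT ⟨0, hn⟩
  exact Finset.card_pos.mpr ⟨s, hs⟩

/-- Every element of `l` is hit by one of the k sets of a minimum cover. Applied to the remaining
samples, this certifies that a guess is too small. -/
theorem IsMinCoverSize.length_le {k τ : ℕ} (hk : IsMinCoverSize S k) {l : List ℕ}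
    (hl : ∀ x ∈ l, x < n) (hτ : ∀ s < m, hitCount S s l < τ) : l.length ≤ k * τ := by
  obtain ⟨⟨T, hT, rfl⟩, -⟩ := hk
  calc l.length ≤ ∑ s ∈ T, hitCount S s l := length_le_sum_hitCount hT hl
    _ ≤ ∑ s ∈ T, τ := Finset.sum_le_sum fun s _ => (hτ s s.2).le
    _ = T.card * τ := by simp

theorem prepareCmd_spec {L g fuel τ : ℕ} {out U R : List ℕ} {M : Mem}
    (h : Holds S L g fuel τ out U R M) (hw : 3 < 2 ^ w) (hL : 6 * L < 2 ^ w)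
    (hr : 6 * L * g < 2 ^ w) :
    DetTriple w S prepareCmd M 9 fun M' => M'.reg 8 = 6 * L * g ∧ M'.reg 9 = 3 * L ∧
      M'.arr = M.arr ∧ ∀ x < 13, x ≠ 8 → x ≠ 9 → M'.reg x = M.reg x := by
  refine DetTriple.const_seq hw <|
    DetTriple.arith_seq (3 * L) (by simp [Op.eval, h.reg3]) (by omega) <|
    DetTriple.arith_seq (6 * L) (by simp [Op.eval]; ring) hL <|
    DetTriple.arith_seq (6 * L * g) (by simp [Op.eval, h.reg4]) hr <|
    DetTriple.skip ⟨by simp, by simp, by simp, fun x hx h8 h9 => ?_⟩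
  have : x ≠ 15 := by omega
  simp [this, h8, h9]

/-- With τ = 3L the sample size was 2τg, so the test asks whether more than half of the samples
remain; the guess is multiplied by one plus the outcome. -/
theorem updateCmd_spec {L g fuel τ : ℕ} {out U R : List ℕ} {M : Mem}
    (h : Holds S L g fuel τ out U R M) (hw : 2 < 2 ^ w) (hR : 2 * R.length < 2 ^ w)
    (hτ : 2 * τ < 2 ^ w) (hτg : 2 * τ * g < 2 ^ w) (hg : 2 * g < 2 ^ w)
    (hUf : U.length * (fuel - 1) < 2 ^ w) (hf : fuel < 2 ^ w) :
    DetTriple w S updateCmd M 17 fun M' =>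
      Holds S L (if 2 * τ * g < 2 * R.length then 2 * g else g) (fuel - 1) τ out U R M' ∧
        M'.reg 18 = U.length * (fuel - 1) := by
  set b := 2 * τ * g < 2 * R.length with hb
  refine DetTriple.arith_seq (2 * R.length) (by simp [Op.eval, h.reg8]; omega) hR <|
    DetTriple.arith_seq (2 * τ) (by simp [Op.eval, h.reg9]; omega) hτ <|
    DetTriple.arith_seq (2 * τ * g) (by simp [Op.eval, h.reg4]) hτg <|
    DetTriple.arith_seq (if b then 1 else 0) (by simp [Op.eval, hb]) (by split_ifs <;> omega) <|
    DetTriple.arith_seq (if b then 2 else 1) (by simp [Op.eval, h.reg2]; split_ifs <;> rfl)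
      (by split_ifs <;> omega) <|
    DetTriple.arith_seq (if b then 2 * g else g)
      (by simp [Op.eval, h.reg4]; split_ifs <;> omega) (by split_ifs <;> omega) <|
    DetTriple.arith_seq (fuel - 1) (by simp [Op.eval, h.reg7, h.reg2]) (by omega) <|
    DetTriple.arith_seq (U.length * (fuel - 1)) (by simp [Op.eval, h.reg5]) hUf <|
    DetTriple.skip ⟨?_, by simp⟩
  constructor
  all_goals simp [h.reg0, h.reg1, h.reg2, h.reg3, h.reg5, h.reg6, h.reg8, h.reg9, h.reg12,
    h.list0, h.list1, h.list2]
  rfl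

/-- A bound for the time of one round. -/
def roundTime (n m k L : ℕ) : ℕ :=
  m * (240 * (k * L) + 50) + 4 * k * (20 * n + 240 * (k * L) + 50) + 144 * (k * L) + 100

-- Apart from the bad event that the guess is kept and `U` keeps more than 15/16 of its length,
-- everything holds for all outcomes, including the invariant g' ≤ 2k. The bad event implies that
-- the sample was misleading.
open Classical in
theorem roundCmd_spec {k L g fuel τ : ℕ} {out R : List ℕ} {M : Mem} (hk : IsMinCoverSize S k)
    (hL0 : 0 < L) (hL : L ≤ n + m) (hw : 1000 * (n + m) ^ 2 < 2 ^ w)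
    (h : Holds S L g fuel τ out (uncovered S out (List.range n)) R M)
    (hg0 : 0 < g) (hg : g ≤ 2 * k) (hfuel : fuel ≤ 33 * L)
    (hnd : out.Nodup) (hout : ∀ s ∈ out, s < m)
    (hU : uncovered S out (List.range n) ≠ []) :
    ProbTriple w S roundCmd M (roundTime n m k L)
      (fun M' => ∃ (T R' : List ℕ) (g' : ℕ),
        Holds S L g' (fuel - 1) (3 * L) (out ++ T) (uncovered S (out ++ T) (List.range n)) R' M' ∧
        (out ++ T).Nodup ∧ (∀ s ∈ T, s < m) ∧ T.length ≤ 4 * k ∧ (g' = g ∨ g' = 2 * g) ∧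
        g' ≤ 2 * k ∧
        M'.reg 18 = (uncovered S (out ++ T) (List.range n)).length * (fuel - 1))
      (fun M' => if M'.reg 4 = g ∧
        15 * (uncovered S out (List.range n)).length < 16 * M'.reg 5 then 1 else 0)
      (m ^ (2 * g) * (2 ^ (6 * L * g))⁻¹) := by
  set U := uncovered S out (List.range n) with hUdef
  have hUn : U.length ≤ n := (length_uncovered_le _ _).trans (by simp)
  have hpos := List.length_pos_iff.mpr hU
  have hkn := hk.le_card
  have hk0 := hk.pos (by omega)
  have hN : n + m ≤ (n + m) ^ 2 := Nat.le_self_pow two_ne_zero _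
  have hLg : L * g ≤ 2 * (n + m) ^ 2 := by
    calc L * g ≤ (n + m) * (2 * (n + m)) := Nat.mul_le_mul hL (by omega)
      _ = _ := by ring
  have hUf : ∀ l : List ℕ, l.length ≤ n → l.length * (fuel - 1) < 2 ^ w := by
    intro l hl
    calc l.length * (fuel - 1) ≤ (n + m) * (33 * (n + m)) := Nat.mul_le_mul (by omega) (by omega)
      _ = 33 * (n + m) ^ 2 := by ring
      _ < 2 ^ w := by omega
  have hr0 : 0 < 6 * L * g := by positivity
  have hr : 6 * L * g = 6 * (L * g) := by ring
  have hrk : 6 * L * g ≤ 12 * (k * L) := by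
    calc 6 * L * g ≤ 6 * L * (2 * k) := by gcongr
      _ = 12 * (k * L) := by ring
  have hdiv : 6 * L * g / (3 * L) = 2 * g := by
    rw [show 6 * L * g = 3 * L * (2 * g) by ring, Nat.mul_div_cancel_left _ (by omega)]
  have hUlt : ∀ x ∈ U, x < n := fun x hx => by simpa using (mem_uncovered.mp hx).1
  have hsample : ProbTriple w S (.seq prepareCmd sampleCmd) M (9 + (12 * (6 * L * g) + 20) + 1)
      (fun M' => ∃ R', R' = M'.list 2 (6 * L * g) ∧ Holds S L g fuel (3 * L) out U R' M' ∧
        ∀ x ∈ R', x ∈ U)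
      (fun M' => if Misleading S (2 * g) U (M'.list 2 (6 * L * g)) then 1 else 0)
      (m ^ (2 * g) * (2 ^ (6 * L * g))⁻¹) := by
    refine ProbTriple.seq (ProbTriple.of_det (f := fun _ => m ^ (2 * g) * (2 ^ (6 * L * g))⁻¹)
      ((prepareCmd_spec h (by omega) (by omega) (by omega)).mono le_rfl
        fun M' h' => ⟨h', le_rfl⟩)) ?_
    rintro M₁ ⟨h8, h9, harr, hreg⟩
    refine (sampleCmd_spec (j := 2 * g) (U := U) 
      (by rw [Mem.list_eq_of_arr (M := M) (by rw [harr]), h.list1]) (by simp [hreg, h.reg2]) (by simp [hreg, h.reg5]) h8 (by simp [hreg, h.reg12]) hU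
      (fun x hx => by have := hUlt x hx; omega) (by omega) hr0 (by omega)).mono le_rfl ?_
      (fun _ _ => le_rfl) le_rfl
    rintro M₂ ⟨hR', harr0, harr1, hreg'⟩
    refine ⟨_, rfl, ?_, hR'⟩
    constructor
    any_goals simp [hreg, hreg', h8, h9, h.reg0, h.reg1, h.reg2, h.reg3, h.reg4, h.reg5, h.reg6,
      h.reg7, h.reg12]
    · rw [Mem.list_eq_of_arr (M := M) (by rw [harr0, harr]), h.list0]
    · rw [Mem.list_eq_of_arr (M := M) (by rw [harr1, harr]), h.list1]
  refine (ProbTriple.seq (t₂ := m * (240 * (k * L) + 50) + 4 * k * (20 * n + 240 * (k * L) + 50) + 10 +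
    17 + 1) hsample ?_).mono (by rw [roundTime]; omega) (fun _ => id) (fun _ _ => le_rfl) le_rfl
  rintro M₁ ⟨R', hR', h', hRU⟩
  have hRl : R'.length = 6 * L * g := by rw [hR', Mem.length_list]
  have hpass := passCmd_spec (w := w) h' (by omega) hRU hnd hout (by omega) (by omega) (by omega)
    (by omega)
  rw [hRl, hdiv] at hpass
  have hpt : m * (20 * (6 * L * g) + 50) + 2 * g * (20 * n + 20 * (6 * L * g) + 50) + 10 ≤
      m * (240 * (k * L) + 50) + 4 * k * (20 * n + 240 * (k * L) + 50) + 10 :=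
    Nat.add_le_add_right (Nat.add_le_add (Nat.mul_le_mul_left m (by omega))
      (Nat.mul_le_mul (by omega) (by omega))) 10
  refine ProbTriple.of_det ((DetTriple.seq (t₂ := 17) (hpass.mono hpt fun _ => id) ?_).mono le_rfl
    fun _ => id)
  rintro M₂ ⟨T, hH, hnd', hT, hlen, hlt⟩
  have hRle := length_uncovered_le (S := S) T R'
  have hle' : (uncovered S (out ++ T) (List.range n)).length ≤ n :=
    (length_uncovered_le _ _).trans (by simp)
  have hTlen : T.length ≤ 2 * g := by
    by_contra hcon
    have : (2 * g + 1) * (3 * L) ≤ T.length * (3 * L) := Nat.mul_le_mul_right _ (by omega)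
    have h3 : (2 * g + 1) * (3 * L) = 6 * L * g + 3 * L := by ring
    omega
  have hτg : 2 * (3 * L) * g = 6 * L * g := by ring
  -- If g ≥ k, fewer than 3L hits for each set would leave at most 3Lk ≤ 3Lg samples, which is half
  -- of them.
  have hcert : 6 * L * g < 2 * (uncovered S T R').length → g < k := by
    intro hlt'
    by_contra hcon
    have h₁ := hk.length_le (l := uncovered S T R')
      (fun x hx => hUlt x (hRU x (mem_uncovered.mp hx).1)) hlt
    have h₂ : k * (3 * L) ≤ g * (3 * L) := Nat.mul_le_mul_right _ (by omega)
    have h₃ : 6 * L * g = 2 * (g * (3 * L)) := by ring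
    omega
  refine (updateCmd_spec hH (by omega) (by omega) (by omega) (by omega) (by omega)
    (hUf _ hle') (by omega)).mono (t := 17) le_rfl ?_
  rintro M₃ ⟨hH₃, h18⟩
  rw [hτg] at hH₃
  refine ⟨⟨T, _, _, hH₃, hnd', hT, by omega, ?_, ?_, h18⟩, ?_⟩
  · split_ifs <;> simp
  · split_ifs with hd
    · have := hcert hd
      omega
    · exact hg
  · by_cases hmis : Misleading S (2 * g) U (M₁.list 2 (6 * L * g))
    · rw [if_pos hmis]; split_ifs <;> simp
    · rw [if_neg hmis, if_neg]
      rintro ⟨h4, hbig⟩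
      -- A kept guess means that the chosen sets cover half of the sample, so they themselves
      -- witness `Misleading`.
      refine hmis ⟨T, hTlen, hT, ?_, ?_⟩
      · rw [← hR', hRl]
        rw [hH₃.reg4] at h4
        split_ifs at h4 with hd <;> omega
      · rwa [hH₃.reg5, uncovered_append] at hbig

/-! ### Initialization -/

theorem logCmd_spec {M : Mem} (h0 : M.reg 0 = n) (h1 : M.reg 1 = m) (hN : 0 < n + m)
    (hw : 4 * (n + m) < 2 ^ w) :
    DetTriple w S logCmd M (8 * (n + m) + 20) fun M' => ∃ L, M'.reg 3 = L ∧ n + m ≤ 2 ^ L ∧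
      2 ^ L < 2 * (n + m) ∧ M'.reg 2 = 1 ∧ M'.reg 12 = 0 ∧ M'.arr = M.arr ∧
      ∀ x < 12, x ≠ 2 → x ≠ 3 → M'.reg x = M.reg x := by
  set I : Mem → Prop := fun M' => ∃ L, M'.reg 3 = L ∧ M'.reg 14 = 2 ^ L ∧ M'.reg 15 = n + m ∧
    2 ^ L < 2 * (n + m) ∧ M'.reg 16 = (if 2 ^ L < n + m then 1 else 0) ∧
    M'.reg 2 = 1 ∧ M'.reg 12 = 0 ∧ M'.arr = M.arr ∧
      ∀ x < 12, x ≠ 2 → x ≠ 3 → M'.reg x = M.reg x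
  refine DetTriple.mono (DetTriple.const_seq (by omega) <| DetTriple.const_seq (by omega) <|
    DetTriple.const_seq (by omega) <|
    DetTriple.arith_seq (n + m) (by simp [Op.eval, h0, h1]) (by omega) <|
    DetTriple.const_seq (by omega) <|
    DetTriple.arith_seq (if 1 < n + m then 1 else 0) (by simp [Op.eval]) (by split_ifs <;> omega) <|
    -- A linear bound for this logarithmic loop is enough, since n + m ≤ mk + nk.
    DetTriple.seq (DetTriple.loop I (fun M' => 8 * (n + m - M'.reg 3)) ?_ ?_)
      fun M' h => DetTriple.skip h) ?_ ?_
  · rintro M' ⟨L, h3, h14, h15, hlt, h16, h2, h12, harr, hreg⟩ hne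
    have hlt' : 2 ^ L < n + m := by
      by_contra hcon
      rw [if_neg hcon] at h16
      exact hne h16
    have hL : L < 2 ^ L := Nat.lt_two_pow_self
    have hpow : 2 ^ (L + 1) = 2 ^ L + 2 ^ L := by ring
    refine ⟨7, DetTriple.arith_seq (2 ^ (L + 1)) (by simp [Op.eval, h14, hpow]) (by omega) <|
      DetTriple.arith_seq (L + 1) (by simp [Op.eval, h3, h2]) (by omega) <|
      DetTriple.arith_seq (if 2 ^ (L + 1) < n + m then 1 else 0) (by simp [Op.eval, h15])
        (by split_ifs <;> omega) <|
      DetTriple.skip ⟨⟨L + 1, by simp, by simp, by simp [h15], by omega, by simp, by simp [h2],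
        by simp [h12], by simp [harr], ?_⟩, ?_⟩⟩
    · intro x hx hx2 hx3
      have : x ≠ 14 ∧ x ≠ 16 := by omega
      simp [this, hx3, hreg x hx hx2 hx3]
    · simp [h3]; omega
  · refine ⟨0, by simp, by simp, by simp, by omega, by simp, by simp, by simp, by simp, ?_⟩
    intro x hx hx2 hx3
    have : x ≠ 12 ∧ x ≠ 14 ∧ x ≠ 15 ∧ x ≠ 16 := by omega
    simp [this, hx2, hx3]
  · simp
  · rintro M' ⟨⟨L, h3, h14, h15, hlt, h16, h2, h12, harr, hreg⟩, h0⟩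
    refine ⟨L, h3, ?_, hlt, h2, h12, harr, hreg⟩
    by_contra hcon
    rw [if_pos (not_le.mp hcon)] at h16
    omega

theorem startCmd_spec {L : ℕ} {M : Mem} (h0 : M.reg 0 = n) (h1 : M.reg 1 = m)
    (h2 : M.reg 2 = 1) (h3 : M.reg 3 = L) (h8 : M.reg 8 = 0) (h9 : M.reg 9 = 0)
    (h12 : M.reg 12 = 0) (hw : 33 < 2 ^ w) (hn : n < 2 ^ w) (hL : 33 * L < 2 ^ w)
    (hnL : n * (33 * L) < 2 ^ w) :
    DetTriple w S startCmd M (8 * n + 25) fun M' =>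
      Holds S L 1 (33 * L) 0 [] (uncovered S [] (List.range n)) [] M' ∧
        M'.reg 18 = n * (33 * L) := by
  set I : Mem → Prop := fun M' => ∃ i, M'.reg 14 = i ∧ M'.reg 13 + i = n ∧
    M'.list 1 i = List.range i ∧ ∀ x < 13, M'.reg x = M.reg x
  refine DetTriple.mono (DetTriple.const_seq (by omega) <|
    DetTriple.arith_seq n (by simp [Op.eval, h0, h12]) hn <|
    DetTriple.seq (t₂ := 13) (DetTriple.loop I (fun M' => 8 * M'.reg 13) ?_ ?_) ?_) ?_ fun _ => id
  · rintro M' ⟨i, h14, h13, hlist, hreg⟩ hne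
    refine ⟨7, DetTriple.store_seq i i h14 h14 (by omega) <|
      DetTriple.arith_seq (i + 1) (by simp [Op.eval, h14, hreg, h2]) (by omega) <|
      DetTriple.arith_seq (M'.reg 13 - 1) (by simp [Op.eval, hreg, h2]) (by omega) <|
      DetTriple.skip ⟨⟨i + 1, by simp, by simp; omega, ?_, ?_⟩, ?_⟩⟩
    · rw [Mem.put_list, Mem.put_list, Mem.list_of_update (M := M') (v := i) (by simp), hlist,
        List.range_succ]
    · intro x hx
      have : x ≠ 13 ∧ x ≠ 14 := by omega
      simp [this, hreg x hx]
    · simp; omega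
  · refine ⟨0, by simp, by simp, by simp, fun x hx => ?_⟩
    have : x ≠ 13 ∧ x ≠ 14 := by omega
    simp [this]
  · rintro M' ⟨⟨i, h14, h13, hlist, hreg⟩, hz⟩
    obtain rfl : i = n := by omega
    refine DetTriple.arith_seq i (by simp [Op.eval, hreg, h0, h12]) hn <|
      DetTriple.const_seq (by omega) <| DetTriple.const_seq (by omega) <|
      DetTriple.const_seq (by omega) <|
      DetTriple.arith_seq (33 * L) (by simp [Op.eval, hreg, h3]) hL <|
      DetTriple.arith_seq (i * (33 * L)) (by simp [Op.eval]) hnL <|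
      DetTriple.skip ⟨?_, by simp⟩
    constructor
    all_goals simp [hreg, h0, h1, h2, h3, h8, h9, h12]
    exact hlist
  · simp

/-! ### The main loop -/

/-- The output is a cover, and the number `j` of rounds satisfies a bound of the form
`j = O(log n)`. -/
def Success (S : Fin m → Finset (Fin n)) (k : ℕ) (M : Mem) : Prop :=
  ∃ (out : List ℕ) (j : ℕ), M.list 0 (M.reg 0) = out ∧ out.Nodup ∧ (∀ s ∈ out, s < m) ∧
    uncovered S out (List.range n) = [] ∧ out.length ≤ 4 * k * j ∧
    15 * 16 ^ j ≤ 15 ^ j * (32 * n ^ 2)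

/-- After `j` rounds, the number `u` of uncovered elements and the guess `g` show that all rounds
made progress. -/
def OnTrack (n j u g : ℕ) : Prop :=
  16 ^ j * u ≤ 15 ^ j * (g * n) ∧ 15 * 16 ^ j ≤ 15 ^ j * (32 * n ^ 2)

/-- Doubling the guess gains the factor 2 ≥ 16/15 on the right, and otherwise `u` loses a sixteenth.
The second clause records that some element was uncovered before this round, so 16^j ≤ 15^j · 2n²;
it bounds the number of rounds in terms of n alone, not n + m. -/
theorem OnTrack.succ {j u u' g g' : ℕ} (h : OnTrack n j u g) (hu : 0 < u) (hg : g ≤ 2 * n)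
    (hu' : u' ≤ u) (hg' : g' = 2 * g ∨ g' = g ∧ 16 * u' ≤ 15 * u) : OnTrack n (j + 1) u' g' := by
  obtain ⟨h₁, h₂⟩ := h
  have h₃ : 16 ^ j * 1 ≤ 15 ^ j * (2 * n * n) :=
    (Nat.mul_le_mul_left _ hu).trans (h₁.trans (by gcongr))
  constructor
  · rcases hg' with rfl | ⟨rfl, hu'⟩
    · calc 16 ^ (j + 1) * u' ≤ 16 ^ (j + 1) * u := by gcongr
        _ = 16 * (16 ^ j * u) := by ring
        _ ≤ 30 * (15 ^ j * (g * n)) := Nat.mul_le_mul (by norm_num) h₁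
        _ = _ := by ring
    · calc 16 ^ (j + 1) * u' = 16 ^ j * (16 * u') := by ring
        _ ≤ 16 ^ j * (15 * u) := by gcongr
        _ = 15 * (16 ^ j * u) := by ring
        _ ≤ 15 * (15 ^ j * (g' * n)) := by gcongr
        _ = _ := by ring
  · calc 15 * 16 ^ (j + 1) = 15 * 16 * (16 ^ j * 1) := by ring
      _ ≤ 15 * 16 * (15 ^ j * (2 * n * n)) := by gcongr
      _ = _ := by ring

/-- The exponent 33 is the least with (16/15)^33 ≥ 8. If u ≥ 1, then 8^L ≤ 2n², although 8^L ≥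
(n+1)³. -/
theorem OnTrack.eq_zero {L u g : ℕ} (h : OnTrack n (33 * L) u g) (hg : g ≤ 2 * n) (hn : 2 ≤ n)
    (hL : n < 2 ^ L) : u = 0 := by
  by_contra hu
  have h₁ : 8 ^ L * 15 ^ (33 * L) ≤ 15 ^ (33 * L) * (2 * n * n) := by
    calc 8 ^ L * 15 ^ (33 * L) = (8 * 15 ^ 33) ^ L := by rw [mul_pow, pow_mul]
      _ ≤ (16 ^ 33) ^ L := Nat.pow_le_pow_left (by norm_num) L
      _ = 16 ^ (33 * L) * 1 := by rw [pow_mul, mul_one]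
      _ ≤ 16 ^ (33 * L) * u := Nat.mul_le_mul_left _ (Nat.pos_of_ne_zero hu)
      _ ≤ 15 ^ (33 * L) * (g * n) := h.1
      _ ≤ _ := by gcongr
  rw [mul_comm] at h₁
  have h₂ := Nat.le_of_mul_le_mul_left h₁ (by positivity)
  have h₃ : (n + 1) ^ 3 ≤ 8 ^ L := by
    calc (n + 1) ^ 3 ≤ (2 ^ L) ^ 3 := Nat.pow_le_pow_left hL 3
      _ = 8 ^ L := by rw [← pow_mul, mul_comm, pow_mul]; norm_num
  nlinarith [Nat.zero_le (n ^ 3)]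

/-- The failure probability that one round may contribute. -/
noncomputable def roundError (n m : ℕ) : ℝ≥0∞ := (((n + m : ℕ) : ℝ≥0∞) ^ 4)⁻¹

/-- With N = n + m, 2^(6Lg) ≥ N^(6g) beats the N^(2g) families of the union bound and leaves
N^(-4g). -/
theorem round_error_le {L g : ℕ} (hL : n + m ≤ 2 ^ L) (hg : 0 < g) (hN : 0 < n + m) :
    (m : ℝ≥0∞) ^ (2 * g) * (2 ^ (6 * L * g))⁻¹ ≤ roundError n m := by
  set N := n + m
  have h2 : (N : ℝ≥0∞) ≤ 2 ^ L := by exact_mod_cast hL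
  rw [← div_eq_mul_inv, roundError, ENNReal.div_le_iff (by simp) (by simp), mul_comm (_)⁻¹,
    ← div_eq_mul_inv, ENNReal.le_div_iff_mul_le (by simp) (by simp)]
  calc (m : ℝ≥0∞) ^ (2 * g) * (N : ℝ≥0∞) ^ 4 ≤ (N : ℝ≥0∞) ^ (2 * g) * (N : ℝ≥0∞) ^ (4 * g) := by
        gcongr
        · exact_mod_cast Nat.le_add_left m n
        · exact_mod_cast hN
        · omega
    _ = (N : ℝ≥0∞) ^ (6 * g) := by rw [← pow_add]; congr 1; ring
    _ ≤ (2 ^ L) ^ (6 * g) := by gcongr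
    _ = _ := by rw [← pow_mul]; congr 1; ring

-- The potential is the indicator of having left the track plus `roundError` for each remaining
-- round; a round converts its own share into the risk of leaving the track.
open Classical in
theorem mainLoop_spec {k L : ℕ} {M : Mem} (hk : IsMinCoverSize S k) (hn : 2 ≤ n)
    (hL : L ≤ n + m) (hL2 : n + m ≤ 2 ^ L) (hw : 1000 * (n + m) ^ 2 < 2 ^ w)
    (h : Holds S L 1 (33 * L) 0 [] (uncovered S [] (List.range n)) [] M)
    (h18 : M.reg 18 = n * (33 * L)) :
    ProbTriple w S (.seq (.loop 18 roundCmd) (.seq (.add 0 6 12) .skip)) M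
      (33 * L * (roundTime n m k L + 1) + 5) (fun _ => True)
      (fun M' => if Success S k M' then 0 else 1) (((33 * L : ℕ) : ℝ≥0∞) * roundError n m) := by
  have hk0 := hk.pos (by omega)
  have hkn := hk.le_card
  have hkm := hk.le_sets
  have hL0 : 0 < L := by
    by_contra hcon
    obtain rfl : L = 0 := by omega
    simp at hL2
    omega
  set I : Mem → Prop := fun M' => ∃ (out R : List ℕ) (g fuel τ : ℕ),
    Holds S L g fuel τ out (uncovered S out (List.range n)) R M' ∧ 0 < g ∧ g ≤ 2 * k ∧
    fuel ≤ 33 * L ∧ out.Nodup ∧ (∀ s ∈ out, s < m) ∧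
    out.length ≤ 4 * k * (33 * L - fuel) ∧
    M'.reg 18 = (uncovered S out (List.range n)).length * fuel with hI
  let φ : Mem → ℝ≥0∞ := fun M' =>
    (if OnTrack n (33 * L - M'.reg 7) (M'.reg 5) (M'.reg 4) then 0 else 1) +
      M'.reg 7 * roundError n m
  set τ : Mem → ℕ := fun M' => M'.reg 7 * (roundTime n m k L + 1) with hτ
  have hMI : I M := ⟨[], [], 1, 33 * L, 0, h, by omega, by omega, le_rfl, by simp, by simp,
    by simp, by simpa using h18⟩
  have hM7 : M.reg 7 = 33 * L := h.reg7
  have hφM : φ M ≤ ((33 * L : ℕ) : ℝ≥0∞) * roundError n m := by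
    have : OnTrack n 0 n 1 := ⟨by simp, by nlinarith⟩
    simp only [φ, hM7, h.reg5, h.reg4, uncovered_nil, List.length_range, Nat.sub_self, if_pos this,
      zero_add]
    exact le_rfl
  have hbody : ∀ M', I M' → M'.reg 18 ≠ 0 → ∃ t ≤ τ M',
      ProbTriple w S roundCmd M' t (fun M'' => I M'' ∧ t + 1 + τ M'' ≤ τ M') φ (φ M') := by
    rintro M' ⟨out, R, g, fuel, τ', hH, hg0, hg, hfuel, hnd, hout, hlen, h18'⟩ hne
    have hne' := Nat.mul_ne_zero_iff.mp (h18' ▸ hne)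
    obtain ⟨f, rfl⟩ : ∃ f, fuel = f + 1 := ⟨fuel - 1, by omega⟩
    have hround := (roundCmd_spec hk hL0 hL hw hH hg0 hg hfuel hnd hout
      (List.ne_nil_of_length_pos (Nat.pos_of_ne_zero hne'.1))).add_const
        ((if OnTrack n (33 * L - (f + 1)) (uncovered S out (List.range n)).length g then 0 else 1) +
          f * roundError n m)
    refine ⟨roundTime n m k L, ?_, hround.mono le_rfl ?_ ?_ ?_⟩
    · simp only [hτ, hH.reg7]
      nlinarith
    · rintro M'' ⟨T, R', g', hH', hnd', hT, hTl, hgg, hg2, h18''⟩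
      rw [Nat.add_sub_cancel] at hH' h18''
      refine ⟨⟨out ++ T, R', g', f, 3 * L, hH', by omega, hg2, by omega, hnd', ?_, ?_, h18''⟩, ?_⟩
      · intro s hs
        rcases List.mem_append.mp hs with hs | hs
        exacts [hout s hs, hT s hs]
      · rw [List.length_append, show 33 * L - f = (33 * L - (f + 1)) + 1 by omega, mul_add]
        omega
      · simp only [hτ, hH.reg7, hH'.reg7]
        linarith
    · rintro M'' ⟨T, R', g', hH', hnd', hT, hTl, hgg, hg2, h18''⟩
      rw [Nat.add_sub_cancel] at hH'
      simp only [φ, hH'.reg7, hH'.reg5, hH'.reg4]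
      rw [← add_assoc]
      gcongr
      by_cases hon : OnTrack n (33 * L - f) (uncovered S (out ++ T) (List.range n)).length g'
      · rw [if_pos hon]; exact zero_le
      rw [if_neg hon]
      by_cases hon' : OnTrack n (33 * L - (f + 1)) (uncovered S out (List.range n)).length g
      swap
      · rw [if_neg hon']; exact le_add_self
      rw [if_pos]
      · exact le_self_add
      -- A round that starts on track can leave it only through the bad event of `roundCmd_spec`.
      by_contra hcon
      refine hon ?_
      rw [show 33 * L - f = (33 * L - (f + 1)) + 1 by omega]
      refine hon'.succ (by omega) (by omega) ?_ ?_
      · rw [uncovered_append]; exact length_uncovered_le _ _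
      · rcases hgg with rfl | rfl
        · right
          simp only [true_and, not_lt] at hcon
          exact ⟨rfl, hcon⟩
        · exact .inl rfl
    · simp only [φ, hH.reg7, hH.reg5, hH.reg4]
      push_cast
      rw [add_mul, one_mul, add_left_comm, add_comm (_ * (_)⁻¹)]
      gcongr
      exact round_error_le hL2 hg0 (by omega)
  refine (ProbTriple.seq (t₂ := 3) (Q := fun _ => True) (ProbTriple.loop I τ φ hbody hMI) ?_).mono
    ?_ (fun _ => id) (fun _ _ => le_rfl) hφM
  · rintro M' ⟨⟨out, R, g, fuel, τ', hH, hg0, hg, hfuel, hnd, hout, hlen, h18'⟩, hz⟩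
    have hql : out.length ≤ m := length_le_of_nodup hnd hout
    have hN : n + m ≤ (n + m) ^ 2 := Nat.le_self_pow two_ne_zero _
    refine ProbTriple.of_det (DetTriple.arith_seq out.length
      (by simp [Op.eval, hH.reg6, hH.reg12]) (by omega) (DetTriple.skip ⟨trivial, ?_⟩))
    split_ifs with hs
    · exact zero_le
    simp only [φ, hH.reg7, hH.reg5, hH.reg4]
    rw [if_neg]
    · exact le_self_add
    intro hon
    refine hs ⟨out, 33 * L - fuel, by simp [hH.list0], hnd, hout, ?_, hlen, hon.2⟩
    rw [← List.length_eq_zero_iff]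
    -- The loop stops because everything is covered, or because all 33L rounds were used; on track,
    -- the latter also means that everything is covered.
    rcases Nat.mul_eq_zero.mp (h18'.symm.trans hz) with h0 | rfl
    · exact h0
    · exact hon.eq_zero (by omega) hn (by omega)
  · simp only [hτ, hM7]; omega

/-! ### The algorithm -/

/-- A bound for the time of the algorithm. -/
def totalTime (n m k L : ℕ) : ℕ :=
  (8 * (n + m) + 20 + (8 * n + 25) + 1) + (33 * L * (roundTime n m k L + 1) + 5) + 1

open Classical in
theorem setCoverCmd_spec {k : ℕ} {M : Mem} (hk : IsMinCoverSize S k) (hn : 2 ≤ n)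
    (hw : 1000 * (n + m) ^ 2 < 2 ^ w) (h0 : M.reg 0 = n) (h1 : M.reg 1 = m)
    (hM : ∀ x ≥ 2, M.reg x = 0) :
    ∃ L, 0 < L ∧ L ≤ n + m ∧ 2 ^ L < 2 * (n + m) ∧
    ProbTriple w S setCoverCmd M (totalTime n m k L) (fun _ => True)
      (fun M' => if Success S k M' then 0 else 1) (((33 * L : ℕ) : ℝ≥0∞) * roundError n m) := by
  have hN : n + m ≤ (n + m) ^ 2 := Nat.le_self_pow two_ne_zero _
  obtain ⟨M₁, ⟨L, h3, hL2, hL3, h2, h12, harr, hreg⟩, t₁, ht₁, e₁⟩ :=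
    logCmd_spec (S := S) h0 h1 (by omega) (w := w) (by omega)
  obtain ⟨L, rfl⟩ : ∃ L', L = L' + 1 := ⟨L - 1, by
    rcases L with _ | L
    · simp at hL2; omega
    · rfl⟩
  have hLN : L + 1 ≤ n + m := by
    have : L < 2 ^ L := Nat.lt_two_pow_self
    rw [pow_succ] at hL3
    omega
  have hnL : n * (33 * (L + 1)) < 2 ^ w := by
    calc n * (33 * (L + 1)) ≤ (n + m) * (33 * (n + m)) := Nat.mul_le_mul (by omega) (by omega)
      _ = 33 * (n + m) ^ 2 := by ring
      _ < 2 ^ w := by omega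
  refine ⟨L + 1, by omega, hLN, hL3, ?_⟩
  have hstart := startCmd_spec (S := S) (w := w) (M := M₁) (by simp [hreg, h0]) (by simp [hreg, h1])
    h2 h3 (by simp [hreg, hM]) (by simp [hreg, hM]) h12 (by omega) (by omega) (by omega) hnL
  have hinit := DetTriple.seq (w := w) (S := S) (c := logCmd) (R := (· = M₁))
    ⟨M₁, rfl, t₁, ht₁, e₁⟩ (by rintro _ rfl; exact hstart)
  exact ProbTriple.seq (ProbTriple.of_det
      (f := fun _ => ((33 * (L + 1) : ℕ) : ℝ≥0∞) * roundError n m)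
      (hinit.mono le_rfl fun M' h => ⟨h, le_rfl⟩))
    fun M' h => mainLoop_spec hk hn hLN hL2 hw h.1 h.2

/-! ### Numerical bounds for time, number of rounds and error -/

theorem roundTime_le {k L : ℕ} (hk : 0 < k) (hkn : k ≤ n) (hL : 0 < L) :
    roundTime n m k L ≤ 1774 * ((m * k + n * k) * L) := by
  have hX : ∀ a, a ≤ m * k + n * k → a ≤ (m * k + n * k) * L := fun a ha =>
    ha.trans (Nat.le_mul_of_pos_right _ hL)
  have h₁ : m * k * L ≤ (m * k + n * k) * L := by gcongr; omega
  have h₂ : m ≤ (m * k + n * k) * L := hX _ (by nlinarith)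
  have h₃ : n * k ≤ (m * k + n * k) * L := hX _ (by omega)
  have h₄ : k * k * L ≤ (m * k + n * k) * L := by gcongr; nlinarith
  have h₅ : k ≤ (m * k + n * k) * L := hX _ (by nlinarith)
  have h₆ : k * L ≤ (m * k + n * k) * L := by gcongr; nlinarith
  have h₇ : 1 ≤ (m * k + n * k) * L := by omega
  rw [roundTime]
  linarith

theorem totalTime_le {k L : ℕ} (hk : 0 < k) (hkn : k ≤ n) (hL : 0 < L) :
    totalTime n m k L ≤ 60000 * ((m * k + n * k) * L ^ 2) := by
  have h₁ : 33 * L * (roundTime n m k L + 1) ≤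
      33 * L * (1774 * ((m * k + n * k) * L)) + 33 * L := by
    rw [mul_add, mul_one]
    gcongr
    exact roundTime_le hk hkn hL
  have h₂ : n + m ≤ m * k + n * k := by nlinarith
  have h₃ : L ≤ L ^ 2 := Nat.le_self_pow two_ne_zero _
  have h₄ : m * k + n * k ≤ (m * k + n * k) * L ^ 2 := Nat.le_mul_of_pos_right _ (by positivity)
  have h₅ : L ^ 2 ≤ (m * k + n * k) * L ^ 2 := Nat.le_mul_of_pos_left _ (by omega)
  have h₆ : 33 * L * (1774 * ((m * k + n * k) * L)) = 58542 * ((m * k + n * k) * L ^ 2) := by ring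
  rw [totalTime]
  omega

/-- L · ln 2 ≤ ln 2 + ln N ≤ 2 ln N, and 2 / ln 2 < 3. -/
theorem log_two_pow_le {N L : ℕ} (hN : 3 ≤ N) (hL : 2 ^ L < 2 * N) : (L : ℝ) ≤ 3 * Real.log N := by
  have h₁ : (L : ℝ) * Real.log 2 ≤ Real.log 2 + Real.log N := by
    rw [← Real.log_pow, ← Real.log_mul (by norm_num) (by positivity)]
    exact Real.log_le_log (by positivity) (by exact_mod_cast hL.le)
  have h₂ : Real.log 2 ≤ Real.log N :=
    Real.log_le_log (by norm_num) (by exact_mod_cast (by omega : 2 ≤ N))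
  have h₃ := Real.log_two_gt_d9
  nlinarith

/-- For n ≥ 2 the factor 32n²/15 is at most n⁴, and ln(16/15) ≥ 1/16. -/
theorem rounds_le {j : ℕ} (hn : 2 ≤ n) (h : 15 * 16 ^ j ≤ 15 ^ j * (32 * n ^ 2)) :
    (j : ℝ) ≤ 64 * Real.log n := by
  have h₁ : (16 : ℝ) ^ j ≤ 15 ^ j * (n : ℝ) ^ 4 := by
    have h₂ : 15 * 16 ^ j ≤ 15 * (15 ^ j * n ^ 4) := by
      have hn4 : 2 ^ 2 * n ^ 2 ≤ n ^ 2 * n ^ 2 := by gcongr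
      calc 15 * 16 ^ j ≤ 15 ^ j * (32 * n ^ 2) := h
        _ ≤ 15 ^ j * (15 * (n ^ 2 * n ^ 2)) := Nat.mul_le_mul_left _ (by omega)
        _ = _ := by ring
    exact_mod_cast Nat.le_of_mul_le_mul_left h₂ (by norm_num)
  have h₂ : (j : ℝ) * Real.log (16 / 15) ≤ 4 * Real.log n := by
    rw [← Real.log_pow, show (4 : ℝ) = (4 : ℕ) by norm_num, ← Real.log_pow]
    refine Real.log_le_log (by positivity) ?_
    rw [div_pow, div_le_iff₀ (by positivity), mul_comm]
    exact h₁
  have h₃ := Real.one_sub_inv_le_log_of_pos (show (0 : ℝ) < 16 / 15 by norm_num)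
  norm_num at h₃
  nlinarith [(Nat.cast_nonneg j : (0 : ℝ) ≤ j)]

theorem Success.returns {k : ℕ} {c : Config} (hn : 2 ≤ n) (hc : c.Halted)
    (h : Success S k c.mem) :
    ∃ T : Finset (Fin m), c.Returns T ∧ IsCover S T ∧ (T.card : ℝ) ≤ 256 * Real.log n * k := by
  obtain ⟨out, j, hlist, hnd, hout, hunc, hlen, hj⟩ := h
  set l : List (Fin m) := out.pmap Fin.mk hout
  have hl : l.map Fin.val = out := by simp [l, List.map_pmap]
  have hlnd : l.Nodup := List.Nodup.of_map Fin.val (by rwa [hl])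
  refine ⟨l.toFinset, ⟨hc, l, hlnd, rfl, by rw [hl, ← hlist]; rfl⟩, fun x => ?_, ?_⟩
  · by_contra! hcon
    have : (x : ℕ) ∈ uncovered S out (List.range n) := by
      refine mem_uncovered.mpr ⟨by simp, fun s hs => ?_⟩
      by_contra hne
      exact hcon ⟨s, hout s hs⟩ (by simp [l, hs]) ((answer_ne_zero_iff ⟨s, hout s hs⟩ x).mp hne)
    simp [hunc] at this
  · rw [List.toFinset_card_of_nodup hlnd, ← List.length_map Fin.val, hl]
    have h₁ : (out.length : ℝ) ≤ 4 * k * j := by exact_mod_cast hlen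
    have h₂ := rounds_le hn hj
    calc (out.length : ℝ) ≤ 4 * k * j := h₁
      _ ≤ 4 * k * (64 * Real.log n) := by gcongr
      _ = _ := by ring

theorem roundError_mul_le {L : ℕ} (hn : 2 ≤ n) (hL : L ≤ n + m) :
    (((33 * L : ℕ) : ℝ≥0∞) * roundError n m).toReal ≤ 33 / (n : ℝ) ^ 2 := by
  have hn' : (2 : ℝ) ≤ n := by exact_mod_cast hn
  have hnN : (n : ℝ) ≤ (n + m : ℕ) := by push_cast; linarith [(Nat.cast_nonneg m : (0 : ℝ) ≤ m)]
  have hL' : (L : ℝ) ≤ (n + m : ℕ) := by exact_mod_cast hL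
  simp only [roundError, ENNReal.toReal_mul, ENNReal.toReal_natCast, ENNReal.toReal_inv,
    ENNReal.toReal_pow]
  set N : ℝ := ((n + m : ℕ) : ℝ)
  rw [← div_eq_mul_inv, div_le_div_iff₀ (by positivity) (by positivity)]
  push_cast
  calc 33 * (L : ℝ) * (n : ℝ) ^ 2 ≤ 33 * N * N ^ 2 := by gcongr
    _ = 33 * (1 * N ^ 3) := by ring
    _ ≤ 33 * (N * N ^ 3) := by gcongr; linarith
    _ = 33 * N ^ 4 := by ring

/-- Markov's inequality in additive form: the indicator of `G` plus `F` is at least 1 everywhere. -/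
theorem one_le_toOuterMeasure_add {α : Type*} (p : PMF α) (G : Set α) (F : α → ℝ≥0∞)
    (hF : ∀ a ∉ G, 1 ≤ F a) : 1 ≤ p.toOuterMeasure G + ∑' a, p a * F a := by
  rw [PMF.toOuterMeasure_apply, ← ENNReal.tsum_add, ← p.tsum_coe]
  refine ENNReal.tsum_le_tsum fun a => ?_
  by_cases ha : a ∈ G
  · rw [Set.indicator_of_mem ha]
    exact le_self_add
  · rw [Set.indicator_of_notMem ha, zero_add]
    exact le_mul_of_one_le_right' (hF a ha)

end SetCoverRAM

/-! ### Assembly of the theorem -/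

open SetCoverRAM in
theorem lemma5p5 :
    ∃ (P : Cmd) (κ p : ℕ) (A B C : ℝ), 0 < A ∧ 0 < B ∧ 0 < C ∧
      ∀ (n m : ℕ) (S : Fin m → Finset (Fin n)) (k w : ℕ),
        2 ≤ n → IsMinCoverSize S k → (n + m) ^ κ ≤ 2 ^ w →
          ∃ t : ℕ,
            (t : ℝ) ≤ C * ((m : ℝ) * k + (n : ℝ) * k) * Real.log ((n : ℝ) + m) ^ p ∧
            HaltsWithin P w S t ∧
            1 - B / (n : ℝ) ^ 2 ≤
              ((run P w S t).toOuterMeasure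
                {c | ∃ T : Finset (Fin m), c.Returns T ∧ IsCover S T ∧
                  (T.card : ℝ) ≤ A * Real.log n * k}).toReal := by
  classical
  -- The exponent 9 comes from 1000N² < 3⁷N² ≤ N⁹ for N = n + m ≥ 3. Further, 256 = 4 · 64 (sets per
  -- round times rounds), 33 comes from the limit on rounds, and 540000 = 60000 · 3².
  refine ⟨setCoverCmd, 9, 2, 256, 33, 540000, by norm_num, by norm_num, by norm_num, ?_⟩
  intro n m S k w hn hk hw
  have hk0 := hk.pos (by omega)
  have hkm := hk.le_sets
  have hN3 : 3 ≤ n + m := by omega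
  have hw' : 1000 * (n + m) ^ 2 < 2 ^ w := by
    calc 1000 * (n + m) ^ 2 < 3 ^ 7 * (n + m) ^ 2 := by gcongr; norm_num
      _ ≤ (n + m) ^ 7 * (n + m) ^ 2 := by gcongr
      _ = (n + m) ^ 9 := by ring
      _ ≤ 2 ^ w := hw
  have hN : n + m ≤ (n + m) ^ 2 := Nat.le_self_pow two_ne_zero _
  set M₀ : Mem := ((⟨fun _ => 0, fun _ _ => 0⟩ : Mem).put 0 n).put 1 m
  have hinit : init setCoverCmd w n m = ⟨[setCoverCmd], M₀⟩ := by
    rw [init, Mem.setReg_eq_put (by omega), Mem.setReg_eq_put (by omega)]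
  obtain ⟨L, hL0, hLN, hL2, hspec⟩ := setCoverCmd_spec (w := w) (M := M₀) hk hn hw' (by simp [M₀])
    (by simp [M₀]) (fun x hx => by simp [M₀, show x ≠ 0 by omega, show x ≠ 1 by omega])
  set F : Config → ℝ≥0∞ := fun c =>
    if c.Halted then (if Success S k c.mem then 0 else 1) else ⊤
  have hexp := hspec [] 0 F 0 (fun c hc => if_neg hc) fun M' _ => by
    rw [expect_zero, add_zero]
    exact (if_pos (show Config.Halted ⟨[], M'⟩ from rfl)).le
  rw [add_zero, add_zero, ← hinit, expect] at hexp
  have htop : ((33 * L : ℕ) : ℝ≥0∞) * roundError n m ≠ ⊤ :=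
    ENNReal.mul_ne_top (ENNReal.natCast_ne_top _) (ENNReal.inv_ne_top.mpr (pow_ne_zero _ (by simp; omega)))
  refine ⟨totalTime n m k L, ?_, ?_, ?_⟩
  · have h₁ : (totalTime n m k L : ℝ) ≤ 60000 * ((m * k + n * k) * L ^ 2) := by
      exact_mod_cast totalTime_le hk0 hk.le_card hL0
    have h₂ := log_two_pow_le hN3 hL2
    push_cast at h₂
    calc (totalTime n m k L : ℝ) ≤ 60000 * ((m * k + n * k) * L ^ 2) := h₁
      _ ≤ 60000 * ((m * k + n * k) * (3 * Real.log (n + m)) ^ 2) := by gcongr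
      _ = _ := by ring
  · intro c hc
    by_contra hhalt
    -- A reachable unfinished configuration would contribute ⊤ to a finite expectation.
    refine ENNReal.ne_top_of_tsum_ne_top (ne_top_of_le_ne_top htop hexp) c ?_
    simp only [F, if_neg hhalt]
    exact ENNReal.mul_top ((PMF.mem_support_iff _ _).mp hc)
  · have h₁ := one_le_toOuterMeasure_add (run setCoverCmd w S (totalTime n m k L))
      {c | ∃ T : Finset (Fin m), c.Returns T ∧ IsCover S T ∧
        (T.card : ℝ) ≤ 256 * Real.log n * k} F fun c hc => by
          simp only [F]
          split_ifs with hhalt hs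
          · exact absurd (hs.returns hn hhalt) hc
          · exact le_rfl
          · exact le_top
    set μ := (run setCoverCmd w S (totalTime n m k L)).toOuterMeasure
      {c | ∃ T : Finset (Fin m), c.Returns T ∧ IsCover S T ∧
        (T.card : ℝ) ≤ 256 * Real.log n * k} with hμ
    have hμ1 : μ ≠ ⊤ := by
      refine ne_top_of_le_ne_top ENNReal.one_ne_top ?_
      rw [hμ, PMF.toOuterMeasure_apply, ← PMF.tsum_coe]
      exact ENNReal.tsum_le_tsum fun c => Set.indicator_le_self _ _ _
    have h₂ := ENNReal.toReal_mono (ENNReal.add_ne_top.mpr ⟨hμ1, htop⟩)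
      (h₁.trans (add_le_add_right hexp μ))
    rw [ENNReal.toReal_add hμ1 htop, ENNReal.toReal_one] at h₂
    linarith [roundError_mul_le (m := m) hn hLN]
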